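/- Let $R$ be a commutative noetherian local ring of depth $t$, and let $M,N$ be finitely generated $R$-modules. Let $\mathrm{NF}(M)$ be the set of prime ideals $\mathfrak p$ of $R$ such that $M_{\mathfrak p}$ is not $R_{\mathfrak p}$-free, and let $\mathrm{Y}^t(R)$ be the set of prime ideals $\mathfrak p$ of $R$ with $\operatorname{depth}R_{\mathfrak p}\ge t$. Let $\underline{\operatorname{Hom}}_R(M,N)$ be the quotient of $\operatorname{Hom}_R(M,N)$ by the homomorphisms that factor through projective modules. Assume that $M$ is $(t+1)$-torsionfree, i.e. $\operatorname{Ext}_R^i(\operatorname{Tr}M,R)=0$ for $1\le i\le t+1$, where $\operatorname{Tr}M$ is the Auslander transpose of $M$ (the cokernel of $P_0^*\to P_1^*$, where $P_1\to P_0\to M\to0$ is a presentation by finitely generated projective modules and $(-)^*=\operatorname{Hom}_R(-,R)$), and that $\mathrm{NF}(M)\cap\mathrm{NF}(N)\subseteq\mathrm{Y}^t(R)$. Here $\operatorname{Ext}^i_R=0$ for $i<0$, and the zero module has depth $\infty$ and finite G-dimension. (1) If $\operatorname{Ext}_R^t(\operatorname{Hom}_R(M,N),R)=0$ and $\operatorname{Ext}_R^{t-1}(N,M)=0$,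 then $\underline{\operatorname{Hom}}_R(M,N)=0$. (2) Suppose that $\operatorname{Hom}_R(M,N)$ has depth at least $2$ and finite G-dimension. Then there is an isomorphism of $R$-modules $$\operatorname{Ext}_R^{t-1}(N,M)\cong\operatorname{Ext}_R^t(\underline{\operatorname{Hom}}_R(M,N),R).$$ In particular, $\operatorname{Ext}_R^{t-1}(N,M)=0$ if and only if $\underline{\operatorname{Hom}}_R(M,N)=0$. -/

import Mathlib

universe u

namespace ARDuality

open CategoryTheory IsLocalRing RingTheory.Sequence

noncomputable section

/-- The `R`-module `Ext^i_R(M, N)` for an integer `i`; it is zero for `i < 0`. -/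
def extModule (R : Type u) [CommRing R] (M N : Type u) [AddCommGroup M] [Module R M]
    [AddCommGroup N] [Module R N] : ℤ → ModuleCat.{u} R
  | Int.ofNat n => ModuleCat.of R (Abelian.Ext (ModuleCat.of R M) (ModuleCat.of R N) n)
  | Int.negSucc _ => ModuleCat.of R PUnit.{u + 1}

/-- The depth of a finitely generated module `M` over a Noetherian local ring `R`: the supremum of
the lengths of `M`-regular sequences in the maximal ideal. For `M ≠ 0` the condition
`(r₁, …, rₙ) M ≠ M` is automatic by Nakayama's lemma; it is not required, so that the zero module
has depth `∞`, which is the usual convention. -/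
def depth (R : Type u) [CommRing R] [IsLocalRing R] (M : Type u) [AddCommGroup M]
    [Module R M] : ℕ∞ :=
  sSup {n : ℕ∞ | ∃ rs : List R, (∀ r ∈ rs, r ∈ maximalIdeal R) ∧ IsWeaklyRegular M rs ∧
    n = (rs.length : ℕ∞)}

/-- The set `Y^n(R)` of prime ideals `p` of `R` with `depth R_p ≥ n`. -/
def depthLocus (R : Type u) [CommRing R] (n : ℕ) : Set (PrimeSpectrum R) :=
  {p | (n : ℕ∞) ≤ depth (Localization.AtPrime p.asIdeal) (Localization.AtPrime p.asIdeal)}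

/-- The non-free locus `NF(M)`: the set of primes `p` such that `M_p` is not `R_p`-free. -/
def nonFreeLocus (R : Type u) [CommRing R] (M : Type u) [AddCommGroup M] [Module R M] :
    Set (PrimeSpectrum R) :=
  (Module.freeLocus R M)ᶜ

/-- For a projective presentation `f : P₁ → P₀` of a module `M = coker f`, the Auslander transpose
`Tr M`, that is, the cokernel of the dual map `f* : P₀* → P₁*`. -/
abbrev transposeOf (R : Type u) [CommRing R] {P₁ P₀ : Type u} [AddCommGroup P₁] [Module R P₁]
    [AddCommGroup P₀] [Module R P₀] (f : P₁ →ₗ[R] P₀) : Type u :=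
  Module.Dual R P₁ ⧸ LinearMap.range f.dualMap

/-- `M` is `n`-torsionfree: `Ext^i_R(Tr M, R) = 0` for `1 ≤ i ≤ n`. The transpose is computed from
a presentation `P₁ → P₀ → M → 0` by finitely generated projective modules; another presentation
changes it only by projective direct summands, so that the condition does not depend on it. -/
def IsTorsionfree (R : Type u) [CommRing R] (n : ℕ) (M : Type u) [AddCommGroup M]
    [Module R M] : Prop :=
  ∃ (P₁ P₀ : ModuleCat.{u} R) (f : P₁ →ₗ[R] P₀) (g : P₀ →ₗ[R] M),
    Module.Finite R P₁ ∧ Module.Projective R P₁ ∧ Module.Finite R P₀ ∧ Module.Projective R P₀ ∧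
    Function.Exact f g ∧ Function.Surjective g ∧
    ∀ i : ℕ, 1 ≤ i → i ≤ n → Subsingleton (extModule R (transposeOf R f) R i)

/-- The homomorphisms `M → N` that factor through a projective module. -/
def projectiveHoms (R : Type u) [CommRing R] (M N : Type u) [AddCommGroup M] [Module R M]
    [AddCommGroup N] [Module R N] : Submodule R (M →ₗ[R] N) where
  carrier := {h | ∃ (P : ModuleCat.{u} R) (a : M →ₗ[R] P) (b : P →ₗ[R] N),
    Module.Projective R P ∧ b ∘ₗ a = h}
  zero_mem' := ⟨ModuleCat.of R PUnit.{u + 1}, 0, 0, inferInstance, by simp⟩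
  add_mem' := by
    rintro _ _ ⟨P, a, b, hP, rfl⟩ ⟨Q, c, d, hQ, rfl⟩
    refine ⟨ModuleCat.of R (P × Q), a.prod c, b.coprod d, ?_, ?_⟩
    · exact inferInstanceAs (Module.Projective R (P × Q))
    · exact LinearMap.coprod_comp_prod b d a c
  smul_mem' := by
    rintro r _ ⟨P, a, b, hP, rfl⟩
    exact ⟨P, a, r • b, hP, LinearMap.smul_comp r b a⟩

/-- The stable Hom module: `Hom_R(M, N)` modulo the homomorphisms that factor through a projective
module. -/
abbrev StableHom (R : Type u) [CommRing R] (M N : Type u) [AddCommGroup M] [Module R M]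
    [AddCommGroup N] [Module R N] : Type u :=
  (M →ₗ[R] N) ⧸ projectiveHoms R M N

/-- Totally reflexive modules, that is, (finitely generated) modules of G-dimension zero. -/
structure IsTotallyReflexive (R : Type u) [CommRing R] (M : Type u) [AddCommGroup M]
    [Module R M] : Prop where
  finite : Module.Finite R M
  bijective_eval : Function.Bijective (Module.Dual.eval R M)
  ext_eq_zero : ∀ i : ℕ, 0 < i → Subsingleton (extModule R M R i)
  ext_dual_eq_zero : ∀ i : ℕ, 0 < i → Subsingleton (extModule R (Module.Dual R M) R i)

/-- `M` has G-dimension at most `n`: there is an exact sequence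
`0 → G_n → ⋯ → G_0 → M → 0` with all `G_i` totally reflexive (possibly zero). -/
def HasGDimLE (R : Type u) [CommRing R] : ℕ → ModuleCat.{u} R → Prop
  | 0, M => IsTotallyReflexive R M
  | n + 1, M => ∃ (G : ModuleCat.{u} R) (f : G →ₗ[R] M), IsTotallyReflexive R G ∧
      Function.Surjective f ∧ HasGDimLE R n (ModuleCat.of R (LinearMap.ker f))

/-- `M` has finite G-dimension. -/
def HasFiniteGDim (R : Type u) [CommRing R] (M : Type u) [AddCommGroup M] [Module R M] : Prop :=
  ∃ n : ℕ, HasGDimLE R n (ModuleCat.of R M)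

end

end ARDuality

/-! Let `I` be the module of maps `M → N` factoring through projectives, i.e. the image of `M* ⊗ N →
Hom(M, N)`, and consider `0 → I → Hom(M, N) → StableHom → 0`. Everything rests on comparing `Ext(N,
M)` with `Ext(I, R)`.

Let `J` be the sum of the stable annihilators of `M` and `N`. Its zero locus lies in `NF(M) ∩
NF(N)`, so by prime avoidance `J` contains a weakly `R`-regular sequence of length `t`, and a module
killed by `J` has no `Ext^i(-, R)` for `i < t`. All error terms are killed by `J`: `StableHom`, the
kernel of `M* ⊗ N → Hom(M, N)`, and the Tor-type kernels met when a syzygy of `N` is tensored with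
`M*`.

Take `t ≥ 1`. Torsionfreeness makes `M` reflexive and gives `Ext^i(M*, R) = 0` for `1 ≤ i ≤ t - 1`.
Dimension shifting, ignoring modules killed by `J`, yields `Ext^{t-1}(N, M**) ≅ Ext^{t-1}(M* ⊗ N, R)
≅ Ext^{t-1}(I, R)` (`nonempty_ext_dual_equiv`, `nonempty_ext_projectiveHoms_equiv`), and the long
exact sequence leads to `Ext^t(StableHom, R)`. If that vanishes, so does `StableHom`: otherwise
`depth R > t` (`subsingleton_stableHom_of_ext`).

For (2), the inequality `Gdim L ≤ depth R - depth L` makes `Ext^i(Hom(M, N), R)` vanish for `i ≥ t -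
1`, so the connecting map is an isomorphism (`HasGDimLE.subsingleton_ext`). Its key case is that an
injection of totally reflexive modules whose cokernel has depth at least `t` has surjective dual
(`surjective_dualMap_of_exact`). -/

namespace ARDuality

open CategoryTheory Abelian

noncomputable section

/-! ### Ext modules and their long exact sequences -/

variable {R : Type u} [CommRing R]

/-- The `R`-module `Ext^n_R(A, B)`. -/
abbrev ExtGroup (R : Type u) [CommRing R] (A B : Type u) [AddCommGroup A] [Module R A]
    [AddCommGroup B] [Module R B] (n : ℕ) : Type u :=
  Ext (ModuleCat.of R A) (ModuleCat.of R B) n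

variable {A B C X Y : Type u} [AddCommGroup A] [Module R A] [AddCommGroup B] [Module R B]
  [AddCommGroup C] [Module R C] [AddCommGroup X] [Module R X] [AddCommGroup Y] [Module R Y]

lemma shortExact_of_linearMap {f : A →ₗ[R] B} {g : B →ₗ[R] C} (hf : Function.Injective f)
    (hg : Function.Surjective g) (h : Function.Exact f g) :
    (ModuleCat.shortComplexOfCompEqZero f g h.linearMap_comp_eq_zero).ShortExact where
  exact := ModuleCat.shortComplex_exact _ h
  mono_f := (ModuleCat.mono_iff_injective _).mpr hf
  epi_g := (ModuleCat.epi_iff_surjective _).mpr hg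

/-- Degree zero `Ext` is `Hom`. -/
def extZeroEquiv (A B : Type u) [AddCommGroup A] [Module R A] [AddCommGroup B] [Module R B] :
    ExtGroup R A B 0 ≃ₗ[R] (A →ₗ[R] B) :=
  Ext.linearEquiv₀.trans (ModuleCat.homLinearEquiv (S := R))

lemma extZeroEquiv_symm_apply (φ : A →ₗ[R] B) :
    (extZeroEquiv A B).symm φ = Ext.mk₀ (ModuleCat.ofHom φ) := rfl

lemma subsingleton_ext_zero_iff : Subsingleton (ExtGroup R A B 0) ↔ Subsingleton (A →ₗ[R] B) :=
  (extZeroEquiv (R := R) A B).toEquiv.subsingleton_congr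

/-- `Ext` is invariant under isomorphisms in the first variable. -/
def extCongrLeft (e : A ≃ₗ[R] B) (Y : Type u) [AddCommGroup Y] [Module R Y] (n : ℕ) :
    ExtGroup R A Y n ≃ₗ[R] ExtGroup R B Y n :=
  LinearEquiv.ofLinearMap
    (Ext.precompOfLinear (Ext.mk₀ (ModuleCat.ofHom e.symm.toLinearMap)) R _ (zero_add n))
    (Ext.precompOfLinear (Ext.mk₀ (ModuleCat.ofHom e.toLinearMap)) R _ (zero_add n))
    (by
      ext x
      change (Ext.mk₀ _).comp ((Ext.mk₀ _).comp x (zero_add n)) (zero_add n) = x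
      rw [Ext.mk₀_comp_mk₀_assoc, ← ModuleCat.ofHom_comp, LinearEquiv.comp_symm]
      exact Ext.mk₀_id_comp x)
    (by
      ext x
      change (Ext.mk₀ _).comp ((Ext.mk₀ _).comp x (zero_add n)) (zero_add n) = x
      rw [Ext.mk₀_comp_mk₀_assoc, ← ModuleCat.ofHom_comp, LinearEquiv.symm_comp]
      exact Ext.mk₀_id_comp x)

/-- `Ext` is invariant under isomorphisms in the second variable. -/
def extCongrRight (X : Type u) [AddCommGroup X] [Module R X] (e : A ≃ₗ[R] B) (n : ℕ) :
    ExtGroup R X A n ≃ₗ[R] ExtGroup R X B n :=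
  LinearEquiv.ofLinearMap
    (Ext.postcompOfLinear (Ext.mk₀ (ModuleCat.ofHom e.toLinearMap)) R _ (add_zero n))
    (Ext.postcompOfLinear (Ext.mk₀ (ModuleCat.ofHom e.symm.toLinearMap)) R _ (add_zero n))
    (by
      ext x
      change (x.comp (Ext.mk₀ _) (add_zero n)).comp (Ext.mk₀ _) (add_zero n) = x
      rw [Ext.comp_assoc_of_second_deg_zero, Ext.mk₀_comp_mk₀, ← ModuleCat.ofHom_comp,
        LinearEquiv.comp_symm]
      exact Ext.comp_mk₀_id x)
    (by
      ext x
      change (x.comp (Ext.mk₀ _) (add_zero n)).comp (Ext.mk₀ _) (add_zero n) = x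
      rw [Ext.comp_assoc_of_second_deg_zero, Ext.mk₀_comp_mk₀, ← ModuleCat.ofHom_comp,
        LinearEquiv.symm_comp]
      exact Ext.comp_mk₀_id x)

lemma subsingleton_ext_congr_left (e : A ≃ₗ[R] B) {n : ℕ}
    (h : Subsingleton (ExtGroup R A Y n)) : Subsingleton (ExtGroup R B Y n) :=
  (extCongrLeft e Y n).toEquiv.subsingleton_congr.mp h

lemma subsingleton_ext_congr_right (e : A ≃ₗ[R] B) {n : ℕ}
    (h : Subsingleton (ExtGroup R X A n)) : Subsingleton (ExtGroup R X B n) :=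
  (extCongrRight X e n).toEquiv.subsingleton_congr.mp h

section LongExact

variable {f : A →ₗ[R] B} {g : B →ₗ[R] C} (hf : Function.Injective f)
  (hg : Function.Surjective g) (h : Function.Exact f g)
include hf hg h

lemma subsingleton_ext_left₁ (n : ℕ) (hB : Subsingleton (ExtGroup R B Y n))
    (hC : Subsingleton (ExtGroup R C Y (n + 1))) : Subsingleton (ExtGroup R A Y n) := by
  refine subsingleton_of_forall_eq 0 fun x => ?_
  obtain ⟨y, rfl⟩ := Ext.contravariant_sequence_exact₁ (shortExact_of_linearMap hf hg h) _ x
    (add_comm 1 n) (hC.elim _ _)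
  rw [show y = 0 from hB.elim _ _, Ext.comp_zero]

lemma subsingleton_ext_left₂ (n : ℕ) (hA : Subsingleton (ExtGroup R A Y n))
    (hC : Subsingleton (ExtGroup R C Y n)) : Subsingleton (ExtGroup R B Y n) := by
  refine subsingleton_of_forall_eq 0 fun x => ?_
  obtain ⟨y, rfl⟩ := Ext.contravariant_sequence_exact₂ (shortExact_of_linearMap hf hg h) _ x
    (hA.elim _ _)
  rw [show y = 0 from hC.elim _ _, Ext.comp_zero]

lemma subsingleton_ext_left₃ (n : ℕ) (hA : Subsingleton (ExtGroup R A Y n))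
    (hB : Subsingleton (ExtGroup R B Y (n + 1))) : Subsingleton (ExtGroup R C Y (n + 1)) := by
  refine subsingleton_of_forall_eq 0 fun x => ?_
  obtain ⟨y, rfl⟩ := Ext.contravariant_sequence_exact₃ (shortExact_of_linearMap hf hg h) _ x
    (hB.elim _ _) (add_comm 1 n)
  rw [show y = 0 from hA.elim _ _, Ext.comp_zero]

lemma subsingleton_ext_right₁ (n : ℕ) (hC : Subsingleton (ExtGroup R X C n))
    (hB : Subsingleton (ExtGroup R X B (n + 1))) : Subsingleton (ExtGroup R X A (n + 1)) := by
  refine subsingleton_of_forall_eq 0 fun x => ?_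
  obtain ⟨y, rfl⟩ := Ext.covariant_sequence_exact₁ _ (shortExact_of_linearMap hf hg h) x
    (hB.elim _ _) rfl
  rw [show y = 0 from hC.elim _ _, Ext.zero_comp]

lemma subsingleton_ext_right₂ (n : ℕ) (hA : Subsingleton (ExtGroup R X A n))
    (hC : Subsingleton (ExtGroup R X C n)) : Subsingleton (ExtGroup R X B n) := by
  refine subsingleton_of_forall_eq 0 fun x => ?_
  obtain ⟨y, rfl⟩ := Ext.covariant_sequence_exact₂ _ (shortExact_of_linearMap hf hg h) x
    (hC.elim _ _)
  rw [show y = 0 from hA.elim _ _, Ext.zero_comp]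

lemma subsingleton_ext_right₃ (n : ℕ) (hB : Subsingleton (ExtGroup R X B n))
    (hA : Subsingleton (ExtGroup R X A (n + 1))) : Subsingleton (ExtGroup R X C n) := by
  refine subsingleton_of_forall_eq 0 fun x => ?_
  obtain ⟨y, rfl⟩ := Ext.covariant_sequence_exact₃ _ (shortExact_of_linearMap hf hg h) x
    rfl (hA.elim _ _)
  rw [show y = 0 from hB.elim _ _, Ext.zero_comp]

/-- The connecting homomorphism is an isomorphism if the neighbouring terms vanish. -/
lemma nonempty_ext_connecting_equiv (n : ℕ) (hB : Subsingleton (ExtGroup R B Y n))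
    (hB' : Subsingleton (ExtGroup R B Y (n + 1))) :
    Nonempty (ExtGroup R A Y n ≃ₗ[R] ExtGroup R C Y (n + 1)) := by
  have hS := shortExact_of_linearMap hf hg h
  refine ⟨LinearEquiv.ofBijective (Ext.precompOfLinear hS.extClass R (ModuleCat.of R Y)
    (add_comm 1 n)) ⟨?_, fun x => ?_⟩⟩
  · rw [← LinearMap.ker_eq_bot, LinearMap.ker_eq_bot']
    intro x hx
    obtain ⟨y, rfl⟩ := Ext.contravariant_sequence_exact₁ hS _ x (add_comm 1 n) hx
    rw [show y = 0 from hB.elim _ _, Ext.comp_zero]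
  · exact Ext.contravariant_sequence_exact₃ hS _ x (hB'.elim _ _) (add_comm 1 n)

lemma nonempty_ext_inflate_equiv (n : ℕ) (hA : ∀ i ≤ n, Subsingleton (ExtGroup R A Y i)) :
    Nonempty (ExtGroup R C Y n ≃ₗ[R] ExtGroup R B Y n) := by
  have hS := shortExact_of_linearMap hf hg h
  refine ⟨LinearEquiv.ofBijective (Ext.precompOfLinear (Ext.mk₀ (ModuleCat.ofHom g)) R
    (ModuleCat.of R Y) (zero_add n)) ⟨?_, fun x => ?_⟩⟩
  · rw [← LinearMap.ker_eq_bot, LinearMap.ker_eq_bot']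
    intro x hx
    cases n with
    | zero =>
      have := hS.epi_g
      exact Ext.precomp_mk₀_injective_of_epi (ModuleCat.of R Y) (ModuleCat.ofHom g)
        (hx.trans (map_zero _).symm)
    | succ n =>
      obtain ⟨y, rfl⟩ := Ext.contravariant_sequence_exact₃ hS _ x hx (add_comm 1 n)
      rw [show y = 0 from (hA n (by lia)).elim _ _, Ext.comp_zero]
  · exact Ext.contravariant_sequence_exact₂ hS _ x ((hA n le_rfl).elim _ _)

/-- Presents `Ext^1(C, Y)` as the cokernel of restriction along `f`, so that questions about it
become questions about extending maps. -/
lemma exists_connecting_linearMap (hB : Subsingleton (ExtGroup R B Y 1)) :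
    ∃ δ : (A →ₗ[R] Y) →ₗ[R] ExtGroup R C Y 1, Function.Surjective δ ∧
      LinearMap.ker δ = LinearMap.range (LinearMap.lcomp R Y f) := by
  have hS := shortExact_of_linearMap hf hg h
  refine ⟨(Ext.precompOfLinear hS.extClass R (ModuleCat.of R Y) (add_comm 1 0)) ∘ₗ
    (extZeroEquiv A Y).symm.toLinearMap, ?_, ?_⟩
  · rw [LinearMap.coe_comp]
    refine Function.Surjective.comp (fun x => ?_) (extZeroEquiv A Y).symm.surjective
    exact Ext.contravariant_sequence_exact₃ hS _ x (hB.elim _ _) (add_comm 1 0)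
  · ext φ
    constructor
    · intro hφ
      obtain ⟨y, hy⟩ := Ext.contravariant_sequence_exact₁ hS _ ((extZeroEquiv A Y).symm φ)
        (add_comm 1 0) hφ
      refine ⟨extZeroEquiv B Y y, (extZeroEquiv A Y).symm.injective ?_⟩
      rw [← hy]
      obtain ⟨ψ, rfl⟩ := (extZeroEquiv B Y).symm.surjective y
      rw [LinearEquiv.apply_symm_apply, extZeroEquiv_symm_apply, extZeroEquiv_symm_apply,
        Ext.mk₀_comp_mk₀]
      rfl
    · rintro ⟨ψ, rfl⟩
      have : (extZeroEquiv A Y).symm (LinearMap.lcomp R Y f ψ) =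
          (Ext.mk₀ (ModuleCat.ofHom f)).comp ((extZeroEquiv B Y).symm ψ) (zero_add 0) := by
        rw [extZeroEquiv_symm_apply, extZeroEquiv_symm_apply, Ext.mk₀_comp_mk₀]
        rfl
      change hS.extClass.comp ((extZeroEquiv A Y).symm (LinearMap.lcomp R Y f ψ)) (add_comm 1 0) = 0
      rw [this]
      exact hS.extClass_comp_assoc _

lemma exists_extend_of_ext_one (hC : Subsingleton (ExtGroup R C Y 1)) (φ : A →ₗ[R] Y) :
    ∃ ψ : B →ₗ[R] Y, ψ ∘ₗ f = φ := by
  have hS := shortExact_of_linearMap hf hg h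
  obtain ⟨y, hy⟩ := Ext.contravariant_sequence_exact₁ hS _ ((extZeroEquiv A Y).symm φ)
    (add_comm 1 0) (hC.elim _ _)
  obtain ⟨ψ, rfl⟩ := (extZeroEquiv B Y).symm.surjective y
  refine ⟨ψ, (extZeroEquiv A Y).symm.injective ?_⟩
  rw [← hy, extZeroEquiv_symm_apply, extZeroEquiv_symm_apply, Ext.mk₀_comp_mk₀]
  rfl

lemma exists_lift_of_ext_one (hA : Subsingleton (ExtGroup R X A 1)) (φ : X →ₗ[R] C) :
    ∃ ψ : X →ₗ[R] B, g ∘ₗ ψ = φ := by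
  have hS := shortExact_of_linearMap hf hg h
  obtain ⟨y, hy⟩ := Ext.covariant_sequence_exact₃ _ hS ((extZeroEquiv X C).symm φ)
    (zero_add 1) (hA.elim _ _)
  obtain ⟨ψ, rfl⟩ := (extZeroEquiv X B).symm.surjective y
  refine ⟨ψ, (extZeroEquiv X C).symm.injective ?_⟩
  rw [← hy, extZeroEquiv_symm_apply, extZeroEquiv_symm_apply]
  exact (Ext.mk₀_comp_mk₀ _ _).symm

end LongExact

lemma subsingleton_ext_zero_of_surjective {g : B →ₗ[R] C} (hg : Function.Surjective g)
    (hB : Subsingleton (ExtGroup R B Y 0)) : Subsingleton (ExtGroup R C Y 0) := by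
  rw [subsingleton_ext_zero_iff] at hB ⊢
  exact ⟨fun a b => LinearMap.cancel_right hg |>.mp (hB.elim (a ∘ₗ g) (b ∘ₗ g))⟩

lemma subsingleton_ext_zero_of_injective {f : A →ₗ[R] B} (hf : Function.Injective f)
    (hB : Subsingleton (ExtGroup R X B 0)) : Subsingleton (ExtGroup R X A 0) := by
  rw [subsingleton_ext_zero_iff] at hB ⊢
  exact ⟨fun a b => LinearMap.cancel_left hf |>.mp (hB.elim (f ∘ₗ a) (f ∘ₗ b))⟩

/-- The scalar can be moved onto the identity of `A`, where it is zero. -/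
lemma ext_smul_eq_zero {a : R} (ha : ∀ x : A, a • x = 0) {n : ℕ} (x : ExtGroup R A B n) :
    a • x = 0 := by
  have : a • 𝟙 (ModuleCat.of R A) = 0 := by
    ext x
    exact ha x
  rw [← Ext.mk₀_id_comp x, ← Ext.smul_comp, ← Ext.mk₀_smul, this, Ext.mk₀_zero, Ext.zero_comp]

lemma subsingleton_ext_of_subsingleton [Subsingleton A] (n : ℕ) :
    Subsingleton (ExtGroup R A B n) :=
  subsingleton_of_forall_eq 0 fun x => by
    rw [← one_smul R x]
    exact ext_smul_eq_zero (fun _ => Subsingleton.elim _ _) x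

lemma subsingleton_ext_projective [Module.Projective R A] (n : ℕ) :
    Subsingleton (ExtGroup R A B (n + 1)) := by
  have : Projective (ModuleCat.of R A) := (IsProjective.iff_projective A).mp inferInstance
  exact Ext.subsingleton_of_projective _ _ _

lemma subsingleton_ext_prod_left {n : ℕ} (hA : Subsingleton (ExtGroup R A Y n))
    (hB : Subsingleton (ExtGroup R B Y n)) : Subsingleton (ExtGroup R (A × B) Y n) :=
  subsingleton_ext_left₂ LinearMap.inl_injective LinearMap.snd_surjective .inl_snd n hA hB

lemma subsingleton_ext_prod_right {n : ℕ} (hA : Subsingleton (ExtGroup R X A n))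
    (hB : Subsingleton (ExtGroup R X B n)) : Subsingleton (ExtGroup R X (A × B) n) :=
  subsingleton_ext_right₂ LinearMap.inl_injective LinearMap.snd_surjective .inl_snd n hA hB

lemma subsingleton_ext_pi_left {n : ℕ} (h : Subsingleton (ExtGroup R A Y n)) (k : ℕ) :
    Subsingleton (ExtGroup R (Fin k → A) Y n) := by
  induction k with
  | zero => exact subsingleton_ext_of_subsingleton n
  | succ k ih =>
    exact subsingleton_ext_congr_left (Fin.consLinearEquiv R fun _ => A)
      (subsingleton_ext_prod_left h ih)

lemma subsingleton_ext_pi_right {n : ℕ} (h : Subsingleton (ExtGroup R X A n)) (k : ℕ) :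
    Subsingleton (ExtGroup R X (Fin k → A) n) := by
  induction k with
  | zero =>
    refine subsingleton_of_forall_eq 0 fun x => ?_
    have : 𝟙 (ModuleCat.of R (Fin 0 → A)) = 0 :=
      ModuleCat.hom_ext (LinearMap.ext fun x => Subsingleton.elim (α := Fin 0 → A) _ _)
    rw [← Ext.comp_mk₀_id x, this, Ext.mk₀_zero, Ext.comp_zero]
  | succ k ih =>
    exact subsingleton_ext_congr_right (Fin.consLinearEquiv R fun _ => A)
      (subsingleton_ext_prod_right h ih)

end

end ARDuality

/-! ### Regular sequences, depth and vanishing of Ext -/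

namespace ARDuality

open CategoryTheory Abelian IsLocalRing RingTheory.Sequence

variable {R : Type u} [CommRing R]
variable {M T : Type u} [AddCommGroup M] [Module R M] [AddCommGroup T] [Module R T]

section QuotSMulTop

variable {x : R} (hx : IsSMulRegular M x)
include hx

lemma subsingleton_ext_quotSMulTop_right (n : ℕ) (h : Subsingleton (ExtGroup R T M n))
    (h' : Subsingleton (ExtGroup R T M (n + 1))) :
    Subsingleton (ExtGroup R T (QuotSMulTop x M) n) :=
  subsingleton_ext_right₃ (f := LinearMap.lsmul R M x) hx (Submodule.mkQ_surjective _)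
    (LinearMap.exact_lsmul_mkQ_smul_top M x) n h h'

/-- Since `x` acts as zero on `Ext^{n+1}(T, M)`, that module is the image of `Ext^n(T, M/xM)`. -/
lemma subsingleton_ext_of_quotSMulTop_right (hT : ∀ y : T, x • y = 0) (n : ℕ)
    (h : Subsingleton (ExtGroup R T (QuotSMulTop x M) n)) :
    Subsingleton (ExtGroup R T M (n + 1)) := by
  refine subsingleton_of_forall_eq 0 fun y => ?_
  have hy : y.comp (Ext.mk₀ ((ModuleCat.of R M).smulShortComplex x).f) (add_zero _) = 0 := by
    rw [ModuleCat.smulShortComplex_f_eq_smul_id]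
    exact (Ext.smul_eq_comp_mk₀ y x).symm.trans (ext_smul_eq_zero hT y)
  obtain ⟨z, hz⟩ := Ext.covariant_sequence_exact₁ _
    (IsSMulRegular.smulShortComplex_shortExact (M := ModuleCat.of R M) hx) y hy rfl
  rw [← hz, show z = 0 from h.elim _ _, Ext.zero_comp]
  rfl

end QuotSMulTop

lemma subsingleton_ext_of_isWeaklyRegular {rs : List R} (hrs : IsWeaklyRegular M rs)
    (hT : ∀ r ∈ rs, ∀ y : T, r • y = 0) (i : ℕ) (hi : i < rs.length) :
    Subsingleton (ExtGroup R T M i) := by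
  induction rs generalizing M i with
  | nil => simp at hi
  | cons a rs ih =>
    rw [isWeaklyRegular_cons_iff] at hrs
    have ha := hT a List.mem_cons_self
    cases i with
    | zero =>
      rw [subsingleton_ext_zero_iff]
      exact hrs.1.linearMap_subsingleton_of_mem_annihilator (Module.mem_annihilator.mpr ha)
    | succ i =>
      exact subsingleton_ext_of_quotSMulTop_right hrs.1 ha i
        (ih hrs.2 (fun r hr => hT r (List.mem_cons_of_mem _ hr)) i (by simpa using hi))

/-- Converse half of Rees' theorem: `Hom(T, M) = 0` produces an `M`-regular element killing `T`, and
passing to `M/xM` costs one degree. -/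
lemma exists_isWeaklyRegular_of_subsingleton_ext [IsNoetherianRing R] [Module.Finite R M]
    [Module.Finite R T] (n : ℕ) (h : ∀ i < n, Subsingleton (ExtGroup R T M i)) :
    ∃ rs : List R, rs.length = n ∧ (∀ r ∈ rs, r ∈ Module.annihilator R T) ∧
      IsWeaklyRegular M rs := by
  induction n generalizing M with
  | zero => exact ⟨[], rfl, by simp, by simp⟩
  | succ n ih =>
    obtain ⟨x, hxT, hx⟩ := IsSMulRegular.subsingleton_linearMap_iff.mp
      (subsingleton_ext_zero_iff.mp (h 0 n.succ_pos))
    obtain ⟨rs, hl, hm, hr⟩ := ih (M := QuotSMulTop x M) fun i hi =>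
      subsingleton_ext_quotSMulTop_right hx i (h i (by lia)) (h (i + 1) (by lia))
    exact ⟨x :: rs, by simp [hl], by simpa [hxT] using hm, by simp [hx, hr]⟩

section Local

variable [IsLocalRing R]

lemma exists_isWeaklyRegular_of_le_depth {n : ℕ} (h : (n : ℕ∞) ≤ depth R M) :
    ∃ rs : List R, (∀ r ∈ rs, r ∈ maximalIdeal R) ∧ IsWeaklyRegular M rs ∧ n ≤ rs.length := by
  cases n with
  | zero => exact ⟨[], by simp, by simp, Nat.zero_le _⟩
  | succ n =>
    have : (n : ℕ∞) < depth R M := lt_of_lt_of_le (by exact_mod_cast n.lt_succ_self) h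
    obtain ⟨_, ⟨rs, h₁, h₂, rfl⟩, hlt⟩ := lt_sSup_iff.mp this
    exact ⟨rs, h₁, h₂, by exact_mod_cast hlt⟩

lemma le_depth_of_isWeaklyRegular {rs : List R} (h : ∀ r ∈ rs, r ∈ maximalIdeal R)
    (hrs : IsWeaklyRegular M rs) : (rs.length : ℕ∞) ≤ depth R M :=
  le_sSup ⟨rs, h, hrs, rfl⟩

lemma residueField_smul_eq_zero {r : R} (hr : r ∈ maximalIdeal R) (y : ResidueField R) :
    r • y = 0 := by
  rw [Algebra.smul_def, ResidueField.algebraMap_eq, (residue_eq_zero_iff r).mpr hr, zero_mul]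

lemma annihilator_residueField_le : Module.annihilator R (ResidueField R) ≤ maximalIdeal R := by
  intro r hr
  have := Module.mem_annihilator.mp hr 1
  rwa [Algebra.smul_def, ResidueField.algebraMap_eq, mul_one, residue_eq_zero_iff] at this

lemma subsingleton_ext_residueField_of_le_depth {n : ℕ} (h : (n : ℕ∞) ≤ depth R M) (i : ℕ)
    (hi : i < n) : Subsingleton (ExtGroup R (ResidueField R) M i) := by
  obtain ⟨rs, h₁, h₂, h₃⟩ := exists_isWeaklyRegular_of_le_depth h
  exact subsingleton_ext_of_isWeaklyRegular h₂
    (fun r hr y => residueField_smul_eq_zero (h₁ r hr) y) i (hi.trans_le h₃)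

lemma le_depth_of_subsingleton_ext [IsNoetherianRing R] [Module.Finite R M] [Module.Finite R T]
    [Nontrivial T] {n : ℕ} (h : ∀ i < n, Subsingleton (ExtGroup R T M i)) :
    (n : ℕ∞) ≤ depth R M := by
  obtain ⟨rs, rfl, hm, hr⟩ := exists_isWeaklyRegular_of_subsingleton_ext n h
  refine le_depth_of_isWeaklyRegular (fun r hr => ?_) hr
  refine le_maximalIdeal (fun htop => ?_) (hm r hr)
  exact not_subsingleton T (Module.annihilator_eq_top_iff.mp htop)

lemma le_depth_iff [IsNoetherianRing R] [Module.Finite R M] {n : ℕ} :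
    (n : ℕ∞) ≤ depth R M ↔ ∀ i < n, Subsingleton (ExtGroup R (ResidueField R) M i) :=
  ⟨subsingleton_ext_residueField_of_le_depth, le_depth_of_subsingleton_ext⟩

lemma depth_congr {N : Type u} [AddCommGroup N] [Module R N] (e : M ≃ₗ[R] N) :
    depth R M = depth R N := by
  simp only [depth, e.isWeaklyRegular_congr]

lemma le_depth_quotSMulTop [IsNoetherianRing R] [Module.Finite R M] {n : ℕ}
    (h : ((n + 1 : ℕ) : ℕ∞) ≤ depth R M) {x : R} (hx : IsSMulRegular M x) :
    (n : ℕ∞) ≤ depth R (QuotSMulTop x M) := by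
  rw [le_depth_iff] at h ⊢
  exact fun i hi => subsingleton_ext_quotSMulTop_right hx i (h i (by lia)) (h (i + 1) (by lia))

end Local

open TensorProduct in
-- An associated prime `p` would stay associated after localization, giving a nonzero element of
-- `M_p` killed by the whole maximal ideal, hence by a regular element.
lemma notMem_associatedPrimes_of_depth_localization [IsNoetherianRing R] (p : Ideal R)
    [p.IsPrime]
    (h : (1 : ℕ∞) ≤ depth (Localization.AtPrime p) (Localization.AtPrime p ⊗[R] M)) :
    p ∉ associatedPrimes R M := by
  intro hp
  rw [← depth_congr (LocalizedModule.equivTensorProduct p.primeCompl M)] at h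
  obtain ⟨rs, hm, hr, hl⟩ := exists_isWeaklyRegular_of_le_depth (n := 1) (by simpa using h)
  have := isAssociatedPrime_iff.mp <| AssociatedPrimes.mem_iff.mp
    (Module.associatedPrimes.mem_associatedPrimes_atPrime_of_mem_associatedPrimes hp)
  obtain ⟨hprime, x, hx⟩ := this
  cases rs with
  | nil => simp at hl
  | cons r rs =>
    have h0 : r • x = r • 0 := by
      have : r ∈ maximalIdeal _ := hm r List.mem_cons_self
      rw [hx] at this
      simpa using this
    rw [((isWeaklyRegular_cons_iff _ _ _).mp hr).1 h0] at hx
    exact hprime.ne_top (by rw [hx]; simp)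

open TensorProduct in
-- Prime avoidance: no associated prime of `M` contains `I`, so `I` is not made of zero divisors. A
-- general `M` is allowed so that the induction can pass to `M/xM`.
lemma exists_isWeaklyRegular_of_depth_localization [IsNoetherianRing R] (I : Ideal R) (n : ℕ)
    [Module.Finite R M]
    (h : ∀ (p : Ideal R) [p.IsPrime], I ≤ p →
      (n : ℕ∞) ≤ depth (Localization.AtPrime p) (Localization.AtPrime p ⊗[R] M)) :
    ∃ rs : List R, rs.length = n ∧ (∀ r ∈ rs, r ∈ I) ∧ IsWeaklyRegular M rs := by
  induction n generalizing M with
  | zero => exact ⟨[], rfl, by simp, by simp⟩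
  | succ n ih =>
    have hx : ∃ x ∈ I, IsSMulRegular M x := by
      by_contra! hcon
      cases subsingleton_or_nontrivial M
      · exact hcon 0 I.zero_mem (IsSMulRegular.zero)
      have hexist : ∃ p ∈ associatedPrimes R M, I ≤ p := by
        rcases associatedPrimes.nonempty R M with ⟨Ia, hIa⟩
        apply (Ideal.subset_union_prime_finite (associatedPrimes.finite R M) Ia Ia _).mp
        · rw [biUnion_associatedPrimes_eq_compl_regular R M]
          exact fun r hr ↦ hcon r hr
        · exact fun I hin _ _ ↦ IsAssociatedPrime.isPrime hin
      obtain ⟨p, hp, hIp⟩ := hexist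
      have := hp.isPrime
      exact notMem_associatedPrimes_of_depth_localization p
        (le_trans (by simp) (h p hIp)) hp
    obtain ⟨x, hxI, hx⟩ := hx
    obtain ⟨rs, hl, hm, hr⟩ := ih (M := QuotSMulTop x M) fun p _ hp => by
      have e := QuotSMulTop.algebraMapTensorEquivTensorQuotSMulTop x M (Localization.AtPrime p)
      rw [← depth_congr e]
      exact le_depth_quotSMulTop (h p hp)
        (hx.of_flat_of_isBaseChange (TensorProduct.isBaseChange R M (Localization.AtPrime p)))
    exact ⟨x :: rs, by simp [hl], by simpa [hxI] using hm, by simp [hx, hr]⟩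

lemma subsingleton_ext_of_zeroLocus_subset_depthLocus [IsNoetherianRing R] {I : Ideal R} {n : ℕ}
    (h : PrimeSpectrum.zeroLocus (I : Set R) ⊆ depthLocus R n)
    (hT : ∀ r ∈ I, ∀ y : T, r • y = 0) (i : ℕ) (hi : i < n) :
    Subsingleton (ExtGroup R T R i) := by
  obtain ⟨rs, rfl, hm, hr⟩ := exists_isWeaklyRegular_of_depth_localization (M := R) I n
    fun p _ hp => by
      rw [depth_congr (TensorProduct.AlgebraTensorModule.rid R (Localization.AtPrime p)
        (Localization.AtPrime p))]
      exact h (show (⟨p, ‹_›⟩ : PrimeSpectrum R) ∈ _ from hp)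
  exact subsingleton_ext_of_isWeaklyRegular hr (fun r hr => hT r (hm r hr)) i hi

end ARDuality

/-! ### The stable annihilator and the modules it kills -/

namespace ARDuality

open CategoryTheory Abelian IsLocalRing RingTheory.Sequence TensorProduct

variable {R : Type u} [CommRing R]
variable {M N : Type u} [AddCommGroup M] [Module R M] [AddCommGroup N] [Module R N]

/-- The ideal of all `s` such that multiplication by `s` on `M` factors through a projective
module, that is, the annihilator of the stable endomorphism ring of `M`. -/
def stableAnnihilator (R : Type u) [CommRing R] (M : Type u) [AddCommGroup M] [Module R M] :
    Ideal R :=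
  (projectiveHoms R M M).comap (LinearMap.toSpanSingleton R (M →ₗ[R] M) LinearMap.id)

lemma mem_stableAnnihilator {s : R} : s ∈ stableAnnihilator R M ↔
    ∃ (P : ModuleCat.{u} R) (a : M →ₗ[R] P) (b : P →ₗ[R] M),
      Module.Projective R P ∧ b ∘ₗ a = s • LinearMap.id := Iff.rfl

lemma projectiveHoms_comp_left {L : Type u} [AddCommGroup L] [Module R L] (g : N →ₗ[R] L)
    {h : M →ₗ[R] N} (hh : h ∈ projectiveHoms R M N) : g ∘ₗ h ∈ projectiveHoms R M L := by
  obtain ⟨P, a, b, hP, rfl⟩ := hh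
  exact ⟨P, a, g ∘ₗ b, hP, rfl⟩

lemma projectiveHoms_comp_right {L : Type u} [AddCommGroup L] [Module R L] (g : L →ₗ[R] M)
    {h : M →ₗ[R] N} (hh : h ∈ projectiveHoms R M N) : h ∘ₗ g ∈ projectiveHoms R L N := by
  obtain ⟨P, a, b, hP, rfl⟩ := hh
  exact ⟨P, a ∘ₗ g, b, hP, rfl⟩

/-- A finite module whose multiplication by `s` factors through a projective module has it
factor through a finite free module. -/
lemma exists_finite_free_of_mem_stableAnnihilator [Module.Finite R M] {s : R}
    (hs : s ∈ stableAnnihilator R M) : ∃ (n : ℕ) (a : M →ₗ[R] (Fin n → R))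
      (b : (Fin n → R) →ₗ[R] M), b ∘ₗ a = s • LinearMap.id := by
  obtain ⟨n, π, hπ⟩ := Module.Finite.exists_fin' R M
  obtain ⟨P, a, b, hP, h⟩ := hs
  obtain ⟨c, hc⟩ := Module.projective_lifting_property π b hπ
  exact ⟨n, c ∘ₗ a, π, by rw [← LinearMap.comp_assoc, hc]; exact h⟩

/-- Dualizing a factorization through a finite free module gives one whose middle term is still
projective. -/
lemma stableAnnihilator_le_dual [Module.Finite R M] :
    stableAnnihilator R M ≤ stableAnnihilator R (Module.Dual R M) := by
  intro s hs
  obtain ⟨n, a, b, h⟩ := exists_finite_free_of_mem_stableAnnihilator hs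
  refine ⟨ModuleCat.of R (Module.Dual R (Fin n → R)), b.dualMap, a.dualMap, ?_, ?_⟩
  · exact inferInstanceAs (Module.Projective R (Module.Dual R (Fin n → R)))
  · ext φ m
    have := congr(φ ($h m))
    simpa using this

lemma exists_lift_of_injective {A B X : Type u} [AddCommGroup A] [Module R A] [AddCommGroup B]
    [Module R B] [AddCommGroup X] [Module R X] {f : A →ₗ[R] B} (hf : Function.Injective f)
    (φ : X →ₗ[R] B) (h : ∀ x, φ x ∈ LinearMap.range f) : ∃ ψ : X →ₗ[R] A, f ∘ₗ ψ = φ := by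
  let e := LinearEquiv.ofInjective f hf
  refine ⟨e.symm.toLinearMap ∘ₗ φ.codRestrict _ h, LinearMap.ext fun x => ?_⟩
  exact congrArg Subtype.val (e.apply_symm_apply (φ.codRestrict _ h x))

section Syzygy

variable {F K : Type u} [AddCommGroup F] [Module R F] [AddCommGroup K] [Module R K]
  {ι : K →ₗ[R] F} {π : F →ₗ[R] N}

/-- If multiplication by `s` on `N` factors through a projective module, then multiplication
by `s` on the kernel of a surjection `F → N` extends to `F`. -/
lemma exists_retraction_of_mem_stableAnnihilator (hι : Function.Injective ι)
    (hπ : Function.Surjective π) (h : Function.Exact ι π) {s : R}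
    (hs : s ∈ stableAnnihilator R N) : ∃ r : F →ₗ[R] K, r ∘ₗ ι = s • LinearMap.id := by
  obtain ⟨P, a, b, hP, hab⟩ := mem_stableAnnihilator.mp hs
  obtain ⟨c, hc⟩ := Module.projective_lifting_property π b hπ
  -- The correction term lifts `s • π`, so `d` lands in the kernel of `π`; it vanishes on that
  -- kernel, so `d` is still multiplication by `s` there.
  let d : F →ₗ[R] F := s • LinearMap.id - c ∘ₗ a ∘ₗ π
  have hmem : ∀ x, d x ∈ LinearMap.range ι := by
    intro x
    rw [← h.linearMap_ker_eq, LinearMap.mem_ker]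
    have h₁ : π (c (a (π x))) = b (a (π x)) := congr($hc (a (π x)))
    have h₂ : b (a (π x)) = s • π x := congr($hab (π x))
    simp [d, h₁, h₂]
  obtain ⟨r, hr⟩ := exists_lift_of_injective hι d hmem
  refine ⟨r, LinearMap.ext fun x => hι ?_⟩
  have : ι (r (ι x)) = d (ι x) := congr($hr (ι x))
  simpa [d, h.apply_apply_eq_zero] using this

lemma stableAnnihilator_le_syzygy [Module.Projective R F] (hι : Function.Injective ι)
    (hπ : Function.Surjective π) (h : Function.Exact ι π) :
    stableAnnihilator R N ≤ stableAnnihilator R K := by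
  intro s hs
  obtain ⟨r, hr⟩ := exists_retraction_of_mem_stableAnnihilator hι hπ h hs
  exact ⟨ModuleCat.of R F, ι, r, ‹_›, hr⟩

/-- This kernel is a quotient of `Tor_1(A, N)`. On the `A` side, `s` passes through a flat module,
where tensoring keeps `ι` injective; on the `N` side, the partial retraction of `ι` is used. -/
lemma smul_eq_zero_of_mem_ker_lTensor (A : Type u) [AddCommGroup A] [Module R A]
    (hι : Function.Injective ι) (hπ : Function.Surjective π) (h : Function.Exact ι π) {s : R}
    (hs : s ∈ stableAnnihilator R A ⊔ stableAnnihilator R N) {z : A ⊗[R] K}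
    (hz : ι.lTensor A z = 0) : s • z = 0 := by
  obtain ⟨s, hs₁, s', hs', rfl⟩ := Submodule.mem_sup.mp hs
  have h₁ : s • z = 0 := by
    obtain ⟨P, a, b, hP, hab⟩ := mem_stableAnnihilator.mp hs₁
    have h0 : a.rTensor K z = 0 := by
      apply Module.Flat.lTensor_preserves_injective_linearMap (M := P) ι hι
      have := congr($(LinearMap.lTensor_comp_rTensor (f := a) (g := ι)) z)
      have h2 := congr($(LinearMap.rTensor_comp_lTensor (f := a) (g := ι)) z)
      rw [map_zero]
      exact (this.trans h2.symm).trans ((congrArg _ hz).trans (map_zero _))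
    have := congr(LinearMap.rTensor K $hab z)
    rw [LinearMap.rTensor_comp, LinearMap.comp_apply, h0, map_zero] at this
    simpa [LinearMap.rTensor_smul] using this.symm
  have h₂ : s' • z = 0 := by
    obtain ⟨r, hr⟩ := exists_retraction_of_mem_stableAnnihilator hι hπ h hs'
    have := congr(LinearMap.lTensor A $hr z)
    rw [LinearMap.lTensor_comp, LinearMap.comp_apply, hz, map_zero] at this
    simpa [LinearMap.lTensor_smul] using this.symm
  rw [add_smul, h₁, h₂, add_zero]

end Syzygy

/-- The map `M* ⊗ N → Hom(M, N)` is bijective if `M` is finite free, or if `M` is finite and `N`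
projective; by naturality, a scalar factoring through such a case kills the kernel. -/
lemma smul_eq_zero_of_mem_ker_dualTensorHom [Module.Finite R M] {s : R}
    (hs : s ∈ stableAnnihilator R M ⊔ stableAnnihilator R N) {z : Module.Dual R M ⊗[R] N}
    (hz : dualTensorHom R M N z = 0) : s • z = 0 := by
  obtain ⟨s, hs₁, s', hs', rfl⟩ := Submodule.mem_sup.mp hs
  have h₁ : s • z = 0 := by
    obtain ⟨n, a, b, hab⟩ := exists_finite_free_of_mem_stableAnnihilator hs₁
    have h0 : b.dualMap.rTensor N z = 0 := by
      apply (dualTensorHom_bijective (R := R) (M := Fin n → R) (N := N)).1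
      have := congr($(dualTensorHom_comp_rTensor_dualMap b) z)
      rw [map_zero]
      refine this.trans ?_
      simp [hz]
    have h2 : a.dualMap ∘ₗ b.dualMap = s • LinearMap.id := by
      ext φ m
      have := congr(φ ($hab m))
      simpa using this
    have := congr(LinearMap.rTensor N $h2 z)
    rw [LinearMap.rTensor_comp, LinearMap.comp_apply, h0, map_zero] at this
    simpa [LinearMap.rTensor_smul] using this.symm
  have h₂ : s' • z = 0 := by
    obtain ⟨P, a, b, hP, hab⟩ := mem_stableAnnihilator.mp hs'
    have h0 : a.lTensor (Module.Dual R M) z = 0 := by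
      apply (dualTensorHom_bijective_of_finite_left_projective_right (R := R) (M := M)
        (N := P)).1
      have := congr($(dualTensorHom_comp_lTensor a) z)
      rw [map_zero]
      refine this.trans ?_
      simp [hz]
    have := congr(LinearMap.lTensor (Module.Dual R M) $hab z)
    rw [LinearMap.lTensor_comp, LinearMap.comp_apply, h0, map_zero] at this
    simpa [LinearMap.lTensor_smul] using this.symm
  rw [add_smul, h₁, h₂, add_zero]

lemma range_dualTensorHom_eq_projectiveHoms [Module.Finite R M] :
    LinearMap.range (dualTensorHom R M N) = projectiveHoms R M N := by
  apply le_antisymm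
  · rintro _ ⟨z, rfl⟩
    induction z with
    | zero => simp
    | add x y hx hy => rw [map_add]; exact add_mem hx hy
    | tmul φ n =>
      refine ⟨ModuleCat.of R R, φ, LinearMap.toSpanSingleton R N n, ?_, ?_⟩
      · exact inferInstanceAs (Module.Projective R R)
      · ext m
        simp
  · rintro _ ⟨P, a, b, hP, rfl⟩
    obtain ⟨z, hz⟩ := (dualTensorHom_bijective_of_finite_left_projective_right (R := R) (M := M)
      (N := P)).2 a
    refine ⟨b.lTensor _ z, ?_⟩
    have := congr($(dualTensorHom_comp_lTensor b) z)
    refine this.trans ?_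
    simp [hz]

lemma stableHom_smul_eq_zero {s : R} (hs : s ∈ stableAnnihilator R M ⊔ stableAnnihilator R N)
    (x : StableHom R M N) : s • x = 0 := by
  obtain ⟨s, hs₁, s', hs', rfl⟩ := Submodule.mem_sup.mp hs
  obtain ⟨h, rfl⟩ := Submodule.mkQ_surjective _ x
  have h₁ := projectiveHoms_comp_left h (show s • LinearMap.id ∈ projectiveHoms R M M from hs₁)
  have h₂ := projectiveHoms_comp_right h (show s' • LinearMap.id ∈ projectiveHoms R N N from hs')
  rw [← map_smul, Submodule.mkQ_apply, Submodule.Quotient.mk_eq_zero]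
  convert add_mem h₁ h₂ using 1
  ext m
  simp [add_smul]

lemma exists_mem_stableAnnihilator_of_mem_freeLocus [Module.FinitePresentation R M]
    {p : PrimeSpectrum R} (hp : p ∈ Module.freeLocus R M) :
    ∃ s ∈ stableAnnihilator R M, s ∉ p.asIdeal := by
  have hfree : Module.Free (Localization p.asIdeal.primeCompl)
    (LocalizedModule p.asIdeal.primeCompl M) := hp
  obtain ⟨n, π, hπ⟩ := Module.Finite.exists_fin' R M
  let S := p.asIdeal.primeCompl
  let fM := LocalizedModule.mkLinearMap S M
  let fF := LocalizedModule.mkLinearMap S (Fin n → R)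
  let π' := LocalizedModule.map S π
  have hπ' : Function.Surjective π' := LocalizedModule.map_surjective S π hπ
  obtain ⟨σ, hσ⟩ := Module.projective_lifting_property π' LinearMap.id hπ'
  -- Clearing denominators in the section `σ`: `a` is a lift of `s • σ`, and a further `t` outside
  -- `p` turns `π ∘ a = s` from an identity after localization into one over `R`.
  obtain ⟨a, s, ha⟩ := Module.FinitePresentation.exists_lift_of_isLocalizedModule S fF
    (σ.restrictScalars R ∘ₗ fM)
  have h1 : fM ∘ₗ (π ∘ₗ a) = fM ∘ₗ ((s : R) • LinearMap.id) := by
    ext m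
    have h2 := congr(π' ($ha m))
    have h3 : π' (σ (fM m)) = fM m := congr($hσ (fM m))
    have h4 : π' (fF (a m)) = fM (π (a m)) := IsLocalizedModule.map_apply S fF fM π (a m)
    have h5 : π' (s • σ (fM m)) = (s : R) • π' (σ (fM m)) :=
      LinearMap.map_smul_of_tower π' (s : R) (σ (fM m))
    rw [h3] at h5
    exact h4.symm.trans (h2.trans (h5.trans (map_smul fM _ _).symm))
  obtain ⟨t, ht⟩ := Module.Finite.exists_smul_of_comp_eq_of_isLocalizedModule S fM _ _ h1
  refine ⟨t * s, ⟨ModuleCat.of R (Fin n → R), a, t.1 • π, ?_, ?_⟩, (t * s).2⟩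
  · exact inferInstanceAs (Module.Projective R (Fin n → R))
  · rw [LinearMap.smul_comp]
    refine ht.trans ?_
    ext m
    simp [mul_smul, Submonoid.smul_def]

lemma zeroLocus_stableAnnihilator_subset [Module.FinitePresentation R M] :
    PrimeSpectrum.zeroLocus (stableAnnihilator R M : Set R) ⊆ nonFreeLocus R M := by
  intro p hp hfree
  obtain ⟨s, hs, hsp⟩ := exists_mem_stableAnnihilator_of_mem_freeLocus hfree
  exact hsp (hp hs)

end ARDuality

/-! ### Ext into a dual as Ext of a tensor product -/

namespace ARDuality

open CategoryTheory Abelian IsLocalRing RingTheory.Sequence TensorProduct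

variable {R : Type u} [CommRing R]

/-- The adjunction isomorphism `Hom(N, A*) ≃ (A ⊗ N)*`. -/
noncomputable def homDualEquiv (A N : Type u) [AddCommGroup A] [Module R A] [AddCommGroup N]
    [Module R N] : (N →ₗ[R] Module.Dual R A) ≃ₗ[R] Module.Dual R (A ⊗[R] N) :=
  LinearMap.lflip.trans (TensorProduct.lift.equiv (RingHom.id R) A N R)

@[simp]
lemma homDualEquiv_tmul {A N : Type u} [AddCommGroup A] [Module R A] [AddCommGroup N]
    [Module R N] (φ : N →ₗ[R] Module.Dual R A) (a : A) (y : N) :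
    homDualEquiv A N φ (a ⊗ₜ y) = φ y a := by
  simp [homDualEquiv]

lemma homDualEquiv_comp {A N K : Type u} [AddCommGroup A] [Module R A] [AddCommGroup N]
    [Module R N] [AddCommGroup K] [Module R K] (φ : N →ₗ[R] Module.Dual R A) (ι : K →ₗ[R] N) :
    homDualEquiv A K (φ ∘ₗ ι) = homDualEquiv A N φ ∘ₗ ι.lTensor A := by
  ext a y
  simp

lemma exists_factor_of_surjective {B C Y : Type u} [AddCommGroup B] [Module R B] [AddCommGroup C]
    [Module R C] [AddCommGroup Y] [Module R Y] {g : B →ₗ[R] C} (hg : Function.Surjective g)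
    (φ : B →ₗ[R] Y) (h : ∀ b, g b = 0 → φ b = 0) : ∃ ψ : C →ₗ[R] Y, ψ ∘ₗ g = φ := by
  refine ⟨(LinearMap.ker g).liftQ φ (fun b hb => h b hb) ∘ₗ (g.quotKerEquivOfSurjective hg).symm.toLinearMap, ?_⟩
  refine LinearMap.ext fun z => ?_
  have : (g.quotKerEquivOfSurjective hg).symm (g z) = (LinearMap.ker g).mkQ z :=
    (LinearEquiv.symm_apply_eq _).mpr rfl
  rw [LinearMap.comp_apply, LinearMap.comp_apply, LinearEquiv.coe_coe, this]
  rfl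

/-- Both `Ext^1` are cokernels of restriction maps, and `Θ` matches the maps that extend on either
side. -/
lemma nonempty_ext_one_equiv {K F N B G C Y Z : Type u} [AddCommGroup K] [Module R K]
    [AddCommGroup F] [Module R F] [AddCommGroup N] [Module R N] [AddCommGroup B] [Module R B]
    [AddCommGroup G] [Module R G] [AddCommGroup C] [Module R C] [AddCommGroup Y] [Module R Y]
    [AddCommGroup Z] [Module R Z] {ι : K →ₗ[R] F} {π : F →ₗ[R] N} (hι : Function.Injective ι)
    (hπ : Function.Surjective π) (hex : Function.Exact ι π)
    (hF : Subsingleton (ExtGroup R F Y 1)) {β : B →ₗ[R] G} {γ : G →ₗ[R] C}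
    (hβ : Function.Injective β) (hγ : Function.Surjective γ) (hex' : Function.Exact β γ)
    (hG : Subsingleton (ExtGroup R G Z 1)) (Θ : (K →ₗ[R] Y) ≃ₗ[R] (B →ₗ[R] Z))
    (hΘ : ∀ φ, (∃ χ, χ ∘ₗ ι = φ) ↔ ∃ ω, ω ∘ₗ β = Θ φ) :
    Nonempty (ExtGroup R N Y 1 ≃ₗ[R] ExtGroup R C Z 1) := by
  obtain ⟨δ, hδ, hδk⟩ := exists_connecting_linearMap hι hπ hex hF
  obtain ⟨ε, hε, hεk⟩ := exists_connecting_linearMap hβ hγ hex' hG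
  have hker : LinearMap.ker δ = LinearMap.ker (ε ∘ₗ Θ.toLinearMap) := by
    ext φ
    have : φ ∈ LinearMap.ker (ε ∘ₗ Θ.toLinearMap) ↔ Θ φ ∈ LinearMap.ker ε := Iff.rfl
    rw [this, hδk, hεk]
    exact hΘ φ
  exact ⟨(δ.quotKerEquivOfSurjective hδ).symm.trans
    ((Submodule.quotEquivOfEq _ _ hker).trans
      ((ε ∘ₗ Θ.toLinearMap).quotKerEquivOfSurjective (hε.comp Θ.surjective)))⟩

lemma nonempty_ext_range_equiv {A B Y : Type u} [AddCommGroup A] [Module R A] [AddCommGroup B]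
    [Module R B] [AddCommGroup Y] [Module R Y] (θ : A →ₗ[R] B) (n : ℕ)
    (h : ∀ i ≤ n, Subsingleton (ExtGroup R (LinearMap.ker θ) Y i)) :
    Nonempty (ExtGroup R (LinearMap.range θ) Y n ≃ₗ[R] ExtGroup R A Y n) :=
  nonempty_ext_inflate_equiv (Submodule.injective_subtype _) θ.surjective_rangeRestrict
    (by rw [LinearMap.exact_iff, LinearMap.ker_rangeRestrict, Submodule.range_subtype]) n h

/-- Dimension shifting in `N`. For a syzygy `K` of `N` in a free `F`, the map `A ⊗ K → A ⊗ F` need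
not be injective, but its kernel is killed by `J` and so invisible to `Ext^i(-, R)` in the relevant
degrees; `A ⊗ K` may be replaced by its image. -/
lemma nonempty_ext_dual_equiv [IsNoetherianRing R] {A : Type u} [AddCommGroup A] [Module R A]
    (J : Ideal R) (n : ℕ) (hA : ∀ i < n, Subsingleton (ExtGroup R A R (i + 1)))
    (hJ : ∀ (T : Type u) [AddCommGroup T] [Module R T], (∀ s ∈ J, ∀ y : T, s • y = 0) →
      ∀ i ≤ n, Subsingleton (ExtGroup R T R i))
    (N : Type u) [AddCommGroup N] [Module R N] [Module.Finite R N]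
    (hN : J ≤ stableAnnihilator R A ⊔ stableAnnihilator R N) :
    Nonempty (ExtGroup R N (Module.Dual R A) n ≃ₗ[R] ExtGroup R (A ⊗[R] N) R n) := by
  induction n generalizing N with
  | zero =>
    exact ⟨((extZeroEquiv N (Module.Dual R A)).trans (homDualEquiv A N)).trans
      (extZeroEquiv (A ⊗[R] N) R).symm⟩
  | succ n ih =>
    obtain ⟨k, π, hπ⟩ := Module.Finite.exists_fin' R N
    let ι := (LinearMap.ker π).subtype
    have hι : Function.Injective ι := Submodule.injective_subtype _
    have hex : Function.Exact ι π := LinearMap.exact_subtype_ker_map π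
    let τ := ι.lTensor A
    have hT : ∀ i ≤ n + 1, Subsingleton (ExtGroup R (LinearMap.ker τ) R i) := by
      refine hJ _ fun s hs y => Subtype.ext ?_
      exact smul_eq_zero_of_mem_ker_lTensor A hι hπ hex (hN hs) y.2
    have hK : J ≤ stableAnnihilator R A ⊔ stableAnnihilator R (LinearMap.ker π) :=
      hN.trans (sup_le_sup_left (stableAnnihilator_le_syzygy hι hπ hex) _)
    have hF : ∀ i < n + 1, Subsingleton (ExtGroup R (A ⊗[R] (Fin k → R)) R (i + 1)) := fun i hi =>
      subsingleton_ext_congr_left (TensorProduct.piScalarRight R R A (Fin k)).symm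
        (subsingleton_ext_pi_left (hA i hi) k)
    have hτ : Function.Surjective τ.rangeRestrict := τ.surjective_rangeRestrict
    have hB : Function.Injective (LinearMap.range τ).subtype := Submodule.injective_subtype _
    have hBπ : Function.Surjective (π.lTensor A) := LinearMap.lTensor_surjective A hπ
    have hBex : Function.Exact (LinearMap.range τ).subtype (π.lTensor A) := by
      rw [LinearMap.exact_iff, Submodule.range_subtype]
      exact (lTensor_exact A hex hπ).linearMap_ker_eq
    cases n with
    -- Degree one is separate: `Hom` out of `F` and `A ⊗ F` need not vanish, so the connecting maps
    -- are only surjective and their kernels must be compared.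
    | zero =>
      have hT0 := subsingleton_ext_zero_iff.mp (hT 0 (by lia))
      -- A functional on `A ⊗ K` descends to the image of `τ` because the kernel of `τ` has zero
      -- dual.
      have hΨ : Function.Bijective (LinearMap.lcomp R R τ.rangeRestrict) := by
        refine ⟨fun a b hab => (LinearMap.cancel_right hτ).mp hab, fun φ => ?_⟩
        refine exists_factor_of_surjective hτ φ fun z hz => ?_
        rw [← LinearMap.mem_ker, LinearMap.ker_rangeRestrict] at hz
        exact congr($(hT0.elim (φ ∘ₗ (LinearMap.ker τ).subtype) 0) ⟨z, hz⟩)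
      let Ψ := LinearEquiv.ofBijective _ hΨ
      refine nonempty_ext_one_equiv hι hπ hex (subsingleton_ext_projective 0) hB hBπ hBex
        (hF 0 (by lia)) ((homDualEquiv A (LinearMap.ker π)).trans Ψ.symm) fun φ => ?_
      have h₁ : ∀ χ : (Fin k → R) →ₗ[R] Module.Dual R A, χ ∘ₗ ι = φ ↔
          homDualEquiv A (Fin k → R) χ ∘ₗ τ = homDualEquiv A (LinearMap.ker π) φ := fun χ => by
        rw [← homDualEquiv_comp, EmbeddingLike.apply_eq_iff_eq]
      have h₂ : ∀ ω : Module.Dual R (A ⊗[R] (Fin k → R)),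
          ω ∘ₗ (LinearMap.range τ).subtype =
            ((homDualEquiv A (LinearMap.ker π)).trans Ψ.symm) φ ↔
          ω ∘ₗ τ = homDualEquiv A (LinearMap.ker π) φ := fun ω => by
        rw [LinearEquiv.trans_apply, LinearEquiv.eq_symm_apply]
        rfl
      simp only [h₁, h₂]
      exact ⟨fun ⟨χ, hχ⟩ => ⟨_, hχ⟩, fun ⟨ω, hω⟩ => ⟨(homDualEquiv A (Fin k → R)).symm ω, by
        rwa [LinearEquiv.apply_symm_apply]⟩⟩
    | succ n =>
      obtain ⟨e₁⟩ := nonempty_ext_connecting_equiv (Y := Module.Dual R A) hι hπ hex (n + 1)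
        (subsingleton_ext_projective _) (subsingleton_ext_projective _)
      obtain ⟨e₂⟩ := ih (fun i hi => hA i (by lia)) (fun T _ _ h i hi => hJ T h i (by lia))
        (LinearMap.ker π) hK
      obtain ⟨e₃⟩ := nonempty_ext_range_equiv (Y := R) τ (n + 1) fun i hi => hT i (by lia)
      obtain ⟨e₄⟩ := nonempty_ext_connecting_equiv (Y := R) hB hBπ hBex (n + 1)
        (hF _ (by lia)) (hF _ (by lia))
      exact ⟨e₁.symm.trans (e₂.trans (e₃.symm.trans e₄))⟩

end ARDuality

/-! ### Torsionfree modules: reflexivity and Ext of the dual -/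

namespace ARDuality

open CategoryTheory Abelian IsLocalRing RingTheory.Sequence TensorProduct

variable {R : Type u} [CommRing R]

lemma subsingleton_extModule_natCast {A B : Type u} [AddCommGroup A] [Module R A] [AddCommGroup B]
    [Module R B] (n : ℕ) :
    Subsingleton (extModule R A B (n : ℤ)) ↔ Subsingleton (ExtGroup R A B n) := Iff.rfl

lemma exact_dualMap {P₁ P₀ M : Type u} [AddCommGroup P₁] [Module R P₁] [AddCommGroup P₀]
    [Module R P₀] [AddCommGroup M] [Module R M] {f : P₁ →ₗ[R] P₀} {g : P₀ →ₗ[R] M}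
    (h : Function.Exact f g) (hg : Function.Surjective g) :
    Function.Exact g.dualMap f.dualMap :=
  LinearMap.exact_lcomp_of_exact_of_surjective R h hg

/-- With `C` the image of `f*`, the sequences `0 → C → P₁* → T → 0` and `0 → M* → P₀* → C → 0` move
the vanishing for `T` down two degrees. The two degrees lost account for injectivity and
surjectivity of biduality. -/
lemma bijective_eval_and_ext_dual {P₁ P₀ M C T : Type u} [AddCommGroup P₁] [Module R P₁]
    [AddCommGroup P₀] [Module R P₀] [AddCommGroup M] [Module R M] [AddCommGroup C] [Module R C]
    [AddCommGroup T] [Module R T] [Module.Finite R P₁] [Module.Projective R P₁]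
    [Module.Finite R P₀] [Module.Projective R P₀] {f : P₁ →ₗ[R] P₀} {g : P₀ →ₗ[R] M}
    (hfg : Function.Exact f g) (hg : Function.Surjective g) {r : Module.Dual R P₀ →ₗ[R] C}
    {s : C →ₗ[R] Module.Dual R P₁} {q : Module.Dual R P₁ →ₗ[R] T} (hr : Function.Surjective r)
    (hs : Function.Injective s) (hsr : s ∘ₗ r = f.dualMap) (hq : Function.Surjective q)
    (hsq : Function.Exact s q) {n : ℕ}
    (hT : ∀ i < n + 2, Subsingleton (ExtGroup R T R (i + 1))) :
    Function.Bijective (Module.Dual.eval R M) ∧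
      ∀ i < n, Subsingleton (ExtGroup R (Module.Dual R M) R (i + 1)) := by
  have hgi : Function.Injective g.dualMap := LinearMap.dualMap_injective_of_surjective hg
  have hgr : Function.Exact g.dualMap r := fun φ => by
    rw [← exact_dualMap hfg hg φ, ← hsr, LinearMap.comp_apply, map_eq_zero_iff s hs]
  have hC : ∀ i < n + 1, Subsingleton (ExtGroup R C R (i + 1)) := fun i hi =>
    subsingleton_ext_left₁ hs hq hsq (i + 1) (subsingleton_ext_projective _)
      (hT (i + 1) (by lia))
  refine ⟨⟨?_, ?_⟩, fun i hi => ?_⟩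
  · rw [injective_iff_map_eq_zero]
    intro m hm
    obtain ⟨p, rfl⟩ := hg m
    -- Evaluation at `p` kills `M*`, so it descends to `C`; it then extends to `P₁*`, where it is
    -- evaluation at some `x`, forcing `p = f x`.
    obtain ⟨ψ, hψ⟩ := exists_factor_of_surjective hr (Module.Dual.eval R P₀ p) fun φ hφ => by
      obtain ⟨χ, rfl⟩ := (hgr φ).mp hφ
      exact congr($hm χ)
    obtain ⟨ω, hω⟩ := exists_extend_of_ext_one hs hq hsq (hT 0 (by lia)) ψ
    obtain ⟨x, rfl⟩ := (Module.bijective_dual_eval R P₁).2 ω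
    have : p = f x := by
      apply (Module.bijective_dual_eval R P₀).1
      rw [← hψ, ← hω, LinearMap.comp_assoc, hsr]
      rfl
    rw [this, hfg.apply_apply_eq_zero]
  · intro ξ
    obtain ⟨ψ, hψ⟩ := exists_extend_of_ext_one hgi hr hgr (hC 0 (by lia)) ξ
    obtain ⟨p, rfl⟩ := (Module.bijective_dual_eval R P₀).2 ψ
    exact ⟨g p, hψ⟩
  · exact subsingleton_ext_left₁ hgi hr hgr (i + 1) (subsingleton_ext_projective _)
      (hC (i + 1) (by lia))

lemma IsTorsionfree.bijective_eval_and_ext_dual {M : Type u} [AddCommGroup M] [Module R M] {n : ℕ}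
    (hM : IsTorsionfree R (n + 2) M) : Function.Bijective (Module.Dual.eval R M) ∧
      ∀ i < n, Subsingleton (ExtGroup R (Module.Dual R M) R (i + 1)) := by
  obtain ⟨P₁, P₀, f, g, _, _, _, _, hfg, hg, hE⟩ := hM
  have hT : ∀ i < n + 2, Subsingleton (ExtGroup R (transposeOf R f) R (i + 1)) := fun i hi =>
    (subsingleton_extModule_natCast _).mp (hE (i + 1) (by lia) (by lia))
  exact ARDuality.bijective_eval_and_ext_dual (C := LinearMap.range f.dualMap) hfg hg
    f.dualMap.surjective_rangeRestrict
    (s := (LinearMap.range f.dualMap).subtype) (q := (LinearMap.range f.dualMap).mkQ)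
    (Submodule.injective_subtype _) rfl (Submodule.mkQ_surjective _)
    (LinearMap.exact_subtype_mkQ _) hT

end ARDuality

/-! ### Totally reflexive modules and G-dimension against depth -/

namespace ARDuality

open CategoryTheory Abelian IsLocalRing RingTheory.Sequence TensorProduct

variable {R : Type u} [CommRing R]

lemma IsTotallyReflexive.ext_succ {G : Type u} [AddCommGroup G] [Module R G]
    (hG : IsTotallyReflexive R G) (i : ℕ) : Subsingleton (ExtGroup R G R (i + 1)) :=
  hG.ext_eq_zero (i + 1) i.succ_pos

lemma IsTotallyReflexive.ext_dual_succ {G : Type u} [AddCommGroup G] [Module R G]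
    (hG : IsTotallyReflexive R G) (i : ℕ) : Subsingleton (ExtGroup R (Module.Dual R G) R (i + 1)) :=
  hG.ext_dual_eq_zero (i + 1) i.succ_pos

section Cokernel

variable {K G L : Type u} [AddCommGroup K] [Module R K] [AddCommGroup G] [Module R G]
  [AddCommGroup L] [Module R L] {ι : K →ₗ[R] G} {π : G →ₗ[R] L}

/-- The cokernel of an injection of totally reflexive modules is totally reflexive if its higher
`Ext` modules with values in `R` vanish. -/
lemma IsTotallyReflexive.of_exact (hK : IsTotallyReflexive R K) (hG : IsTotallyReflexive R G)
    (hι : Function.Injective ι) (hπ : Function.Surjective π) (hex : Function.Exact ι π)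
    (hL : ∀ i, Subsingleton (ExtGroup R L R (i + 1))) : IsTotallyReflexive R L := by
  have hfin := hG.finite
  have hπi : Function.Injective π.dualMap := LinearMap.dualMap_injective_of_surjective hπ
  -- Vanishing of `Ext^1(L, R)` makes `0 → L* → G* → K* → 0` exact; the rest is a comparison with
  -- its dual.
  have hιs : Function.Surjective ι.dualMap := exists_extend_of_ext_one hι hπ hex (hL 0)
  have hdex : Function.Exact π.dualMap ι.dualMap := exact_dualMap hex hπ
  refine ⟨Module.Finite.of_surjective π hπ, ⟨?_, ?_⟩, fun i hi => ?_, fun i hi => ?_⟩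
  · rw [injective_iff_map_eq_zero]
    intro l hl
    obtain ⟨p, rfl⟩ := hπ l
    obtain ⟨ψ, hψ⟩ := exists_factor_of_surjective hιs (Module.Dual.eval R G p) fun φ hφ => by
      obtain ⟨χ, rfl⟩ := (hdex φ).mp hφ
      exact congr($hl χ)
    obtain ⟨q, rfl⟩ := hK.bijective_eval.2 ψ
    have : p = ι q := by
      apply hG.bijective_eval.1
      rw [← hψ]
      rfl
    rw [this, hex.apply_apply_eq_zero]
  · intro ξ
    obtain ⟨ψ, hψ⟩ := exists_extend_of_ext_one hπi hιs hdex (hK.ext_dual_succ 0) ξ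
    obtain ⟨p, rfl⟩ := hG.bijective_eval.2 ψ
    exact ⟨π p, hψ⟩
  · obtain ⟨i, rfl⟩ := Nat.exists_eq_succ_of_ne_zero hi.ne'
    exact hL i
  · obtain ⟨i, rfl⟩ := Nat.exists_eq_succ_of_ne_zero hi.ne'
    exact subsingleton_ext_left₁ hπi hιs hdex (i + 1) (hG.ext_dual_succ i)
      (hK.ext_dual_succ (i + 1))

end Cokernel

lemma HasGDimLE.isTotallyReflexive (n : ℕ) {L : Type u} [AddCommGroup L] [Module R L]
    (h : HasGDimLE R n (ModuleCat.of R L)) (hL : ∀ i, Subsingleton (ExtGroup R L R (i + 1))) :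
    IsTotallyReflexive R L := by
  induction n generalizing L with
  | zero => exact h
  | succ n ih =>
    obtain ⟨G, π, hG, hπ, hK⟩ := h
    have hex := LinearMap.exact_subtype_ker_map π
    refine IsTotallyReflexive.of_exact (ih hK fun i => ?_) hG (Submodule.injective_subtype _) hπ
      hex hL
    exact subsingleton_ext_left₁ (Submodule.injective_subtype _) hπ hex (i + 1) (hG.ext_succ i)
      (hL (i + 1))

section Local

variable [IsNoetherianRing R] [IsLocalRing R]

/-- Vanishing of the higher `Ext(A, R)` lets a free resolution of `A` dualize to a free coresolution
of `A*`, so `A*` is an arbitrarily high syzygy. -/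
lemma ext_residueField_dual (t : ℕ) (ht : ∀ i < t, Subsingleton (ExtGroup R (ResidueField R) R i))
    {A : Type u} [AddCommGroup A] [Module R A] [Module.Finite R A]
    (hA : ∀ i, Subsingleton (ExtGroup R A R (i + 1))) (i : ℕ) (hi : i < t) :
    Subsingleton (ExtGroup R (ResidueField R) (Module.Dual R A) i) := by
  induction i generalizing A with
  | zero =>
    obtain ⟨k, π, hπ⟩ := Module.Finite.exists_fin' R A
    exact subsingleton_ext_zero_of_injective (f := π.dualMap)
      (LinearMap.dualMap_injective_of_surjective hπ)
      (subsingleton_ext_congr_right (Pi.basisFun R (Fin k)).toDualEquiv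
        (subsingleton_ext_pi_right (ht 0 hi) k))
  | succ i ih =>
    obtain ⟨k, π, hπ⟩ := Module.Finite.exists_fin' R A
    have hex := LinearMap.exact_subtype_ker_map π
    have hι := Submodule.injective_subtype (LinearMap.ker π)
    have hK : ∀ i, Subsingleton (ExtGroup R (LinearMap.ker π) R (i + 1)) := fun i =>
      subsingleton_ext_left₁ hι hπ hex (i + 1) (subsingleton_ext_projective _) (hA (i + 1))
    have hιs : Function.Surjective (LinearMap.ker π).subtype.dualMap :=
      exists_extend_of_ext_one hι hπ hex (hA 0)
    exact subsingleton_ext_right₁ (f := π.dualMap) (LinearMap.dualMap_injective_of_surjective hπ)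
      hιs (exact_dualMap hex hπ) i (ih hK (by lia))
      (subsingleton_ext_congr_right (Pi.basisFun R (Fin k)).toDualEquiv
        (subsingleton_ext_pi_right (ht (i + 1) hi) k))

lemma IsTotallyReflexive.ext_residueField {t : ℕ} (ht : depth R R = t) {G : Type u}
    [AddCommGroup G] [Module R G] (hG : IsTotallyReflexive R G) (i : ℕ) (hi : i < t) :
    Subsingleton (ExtGroup R (ResidueField R) G i) := by
  have := hG.finite
  exact subsingleton_ext_congr_right (LinearEquiv.ofBijective _ hG.bijective_eval).symm
    (ext_residueField_dual t (fun i hi => subsingleton_ext_residueField_of_le_depth ht.ge i hi)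
      hG.ext_dual_succ i hi)

/-- A linear map `A₀ → A₁` is surjective if `Hom(A₁, W) → Hom(A₀, W)` is injective with a cokernel
whose depth is at least that of `W`. -/
lemma surjective_of_lcomp_injective (n : ℕ) {A₀ A₁ W : Type u} [AddCommGroup A₀] [Module R A₀]
    [AddCommGroup A₁] [Module R A₁] [AddCommGroup W] [Module R W] [Module.Finite R A₀]
    [Module.Finite R A₁] [Module.Finite R W] (f : A₀ →ₗ[R] A₁)
    (hA₀ : ∀ i < n, Subsingleton (ExtGroup R A₀ W (i + 1)))
    (hA₁ : ∀ i < n, Subsingleton (ExtGroup R A₁ W (i + 1)))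
    (hW : ∀ i < n, Subsingleton (ExtGroup R (ResidueField R) W i))
    (hWn : ¬ Subsingleton (ExtGroup R (ResidueField R) W n))
    (hf : Function.Injective (LinearMap.lcomp R W f))
    (hZ : ∀ i < n, Subsingleton (ExtGroup R (ResidueField R)
      ((A₀ →ₗ[R] W) ⧸ LinearMap.range (LinearMap.lcomp R W f)) i)) :
    Function.Surjective f := by
  induction n generalizing W with
  | zero =>
    rw [← LinearMap.range_eq_top]
    by_contra hne
    -- Some `W`-regular `x` then kills the cokernel of `f`. A nonzero cokernel would put `x` in the
    -- maximal ideal, against `Hom(k, W) ≠ 0`.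
    have hE : Subsingleton ((A₁ ⧸ LinearMap.range f) →ₗ[R] W) := by
      refine ⟨fun a b => ?_⟩
      apply LinearMap.cancel_right (LinearMap.range f).mkQ_surjective |>.mp
      apply hf
      ext y
      have : (LinearMap.range f).mkQ (f y) = 0 := by simp
      simp only [LinearMap.lcomp_apply, LinearMap.comp_apply, this, map_zero]
    obtain ⟨x, hx, hxW⟩ := IsSMulRegular.subsingleton_linearMap_iff.mp hE
    have hnt : Nontrivial (A₁ ⧸ LinearMap.range f) := Submodule.Quotient.nontrivial_iff.mpr hne
    refine hWn (subsingleton_ext_zero_iff.mpr (hxW.linearMap_subsingleton_of_mem_annihilator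
      (Module.mem_annihilator.mpr fun y => residueField_smul_eq_zero ?_ y)))
    refine le_maximalIdeal (fun htop => ?_) hx
    exact not_subsingleton _ (Module.annihilator_eq_top_iff.mp htop)
  | succ n ih =>
    let Z := (A₀ →ₗ[R] W) ⧸ LinearMap.range (LinearMap.lcomp R W f)
    -- The product `W × Z` yields a single element regular on both factors.
    obtain ⟨x, hxk, hx⟩ := IsSMulRegular.subsingleton_linearMap_iff.mp
      (subsingleton_ext_zero_iff.mp
        (subsingleton_ext_prod_right (hW 0 n.succ_pos) (hZ 0 n.succ_pos)))
    have hxW : IsSMulRegular W x := fun a b hab => congrArg Prod.fst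
      (@hx (a, 0) (b, 0) (Prod.ext hab rfl))
    have hxZ : IsSMulRegular Z x := fun a b hab => congrArg Prod.snd
      (@hx (0, a) (0, b) (Prod.ext rfl hab))
    let q : W →ₗ[R] QuotSMulTop x W := Submodule.mkQ _
    have hq : Function.Surjective q := Submodule.mkQ_surjective _
    have hqex : Function.Exact (LinearMap.lsmul R W x) q := LinearMap.exact_lsmul_mkQ_smul_top W x
    have hlift : ∀ φ : A₀ →ₗ[R] W, q ∘ₗ φ = 0 → ∃ χ : A₀ →ₗ[R] W, x • χ = φ :=
      fun φ hφ => exists_lift_of_injective (f := LinearMap.lsmul R W x) hxW φ fun y =>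
        (hqex (φ y)).mp congr($hφ y)
    -- Regularity of `x` on `Z` is what preserves injectivity modulo `x`: if `x • χ` comes from
    -- `A₁`, so does `χ`.
    have hf' : Function.Injective (LinearMap.lcomp R (QuotSMulTop x W) f) := by
      rw [injective_iff_map_eq_zero]
      intro ψ hψ
      obtain ⟨φ, rfl⟩ := exists_lift_of_ext_one (f := LinearMap.lsmul R W x) hxW hq hqex (hA₁ 0 n.succ_pos) ψ
      obtain ⟨χ, hχ⟩ := hlift (φ ∘ₗ f) hψ
      have h0 : x • (Submodule.mkQ _ χ : Z) = 0 := by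
        rw [← map_smul, hχ]
        exact (Submodule.Quotient.mk_eq_zero _).mpr ⟨φ, rfl⟩
      obtain ⟨χ', rfl⟩ := (Submodule.Quotient.mk_eq_zero _).mp (hxZ (h0.trans (smul_zero x).symm))
      have : φ = x • χ' := hf hχ.symm
      rw [this]
      ext y
      exact hqex.apply_apply_eq_zero (χ' y)
    refine ih (W := QuotSMulTop x W)
      (fun i hi => subsingleton_ext_quotSMulTop_right hxW _ (hA₀ i (by lia)) (hA₀ (i + 1) (by lia)))
      (fun i hi => subsingleton_ext_quotSMulTop_right hxW _ (hA₁ i (by lia)) (hA₁ (i + 1) (by lia)))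
      (fun i hi => subsingleton_ext_quotSMulTop_right hxW _ (hW i (by lia)) (hW (i + 1) (by lia)))
      (fun h => hWn (subsingleton_ext_of_quotSMulTop_right hxW
        (Module.mem_annihilator.mp hxk) n h)) hf' fun i hi => ?_
    let Q : (A₀ →ₗ[R] W) →ₗ[R] (A₀ →ₗ[R] QuotSMulTop x W) := q.compRight R
    have hQ : LinearMap.range (LinearMap.lcomp R W f) ≤
        (LinearMap.range (LinearMap.lcomp R (QuotSMulTop x W) f)).comap Q := by
      rintro _ ⟨φ, rfl⟩
      exact ⟨q ∘ₗ φ, rfl⟩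
    let p := Submodule.mapQ _ _ Q hQ
    -- The cokernel formed with `W/xW` is `Z/xZ`, which loses one degree of vanishing.
    refine subsingleton_ext_right₃ (f := LinearMap.lsmul R Z x) (g := p) hxZ ?_ ?_ i
      (hZ i (by lia)) (hZ (i + 1) (by lia))
    · intro z
      obtain ⟨ψ, rfl⟩ := Submodule.mkQ_surjective _ z
      obtain ⟨φ, rfl⟩ := exists_lift_of_ext_one (f := LinearMap.lsmul R W x) hxW hq hqex
        (hA₀ 0 n.succ_pos) ψ
      exact ⟨Submodule.mkQ _ φ, rfl⟩
    · intro z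
      obtain ⟨φ, rfl⟩ := Submodule.mkQ_surjective _ z
      constructor
      · intro hφ
        obtain ⟨ψ, hψ⟩ := (Submodule.Quotient.mk_eq_zero _).mp hφ
        obtain ⟨ω, rfl⟩ := exists_lift_of_ext_one (f := LinearMap.lsmul R W x) hxW hq hqex
          (hA₁ 0 n.succ_pos) ψ
        obtain ⟨χ, hχ⟩ := hlift (φ - ω ∘ₗ f) (by
          rw [LinearMap.comp_sub, sub_eq_zero]
          exact hψ.symm)
        refine ⟨Submodule.mkQ _ χ, ?_⟩
        refine (map_smul (Submodule.mkQ _) x χ).symm.trans ?_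
        rw [hχ, map_sub, sub_eq_self]
        exact (Submodule.Quotient.mk_eq_zero _).mpr ⟨ω, rfl⟩
      · rintro ⟨z, hz⟩
        obtain ⟨χ, rfl⟩ := Submodule.mkQ_surjective _ z
        rw [← hz]
        have : q ∘ₗ (x • χ) = 0 := LinearMap.ext fun y => hqex.apply_apply_eq_zero (χ y)
        exact (Submodule.Quotient.mk_eq_zero _).mpr (by
          rw [show Q (x • χ) = 0 from this]
          exact zero_mem _)

/-- An injection of modules which are dual to `A₁` and `A₀` is dual to a surjection if its cokernel
has maximal depth. -/
lemma surjective_dualMap_of_exact {t : ℕ} (ht : depth R R = t) {K G Z : Type u} [AddCommGroup K]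
    [Module R K] [AddCommGroup G] [Module R G] [AddCommGroup Z] [Module R Z]
    (hK : IsTotallyReflexive R K) (hG : IsTotallyReflexive R G) {ι : K →ₗ[R] G} {π : G →ₗ[R] Z}
    (hι : Function.Injective ι) (hπ : Function.Surjective π) (hex : Function.Exact ι π)
    (hZ : ∀ i < t, Subsingleton (ExtGroup R (ResidueField R) Z i)) :
    Function.Surjective ι.dualMap := by
  have := hK.finite
  have := hG.finite
  let eK := LinearEquiv.ofBijective _ hK.bijective_eval
  let eG := LinearEquiv.ofBijective _ hG.bijective_eval
  have hcomm : ∀ y, LinearMap.lcomp R R ι.dualMap (eK y) = eG (ι y) := fun y => rfl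
  refine surjective_of_lcomp_injective t ι.dualMap (fun i _ => hG.ext_dual_succ i)
    (fun i _ => hK.ext_dual_succ i) (fun i hi => subsingleton_ext_residueField_of_le_depth ht.ge i hi)
    (fun h => ?_) (fun a b hab => ?_) fun i hi => ?_
  -- `Ext^t(k, R)` is nonzero because the depth of `R` is exactly `t`.
  · have : ((t + 1 : ℕ) : ℕ∞) ≤ depth R R := le_depth_of_subsingleton_ext (T := ResidueField R)
      fun i hi => (Nat.lt_succ_iff_lt_or_eq.mp hi).elim
        (fun hi => subsingleton_ext_residueField_of_le_depth ht.ge i hi) (fun hi => hi ▸ h)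
    rw [ht] at this
    exact absurd (Nat.cast_le.mp this) (by lia)
  · obtain ⟨a, rfl⟩ := eK.surjective a
    obtain ⟨b, rfl⟩ := eK.surjective b
    rw [hcomm, hcomm] at hab
    rw [hι (eG.injective hab)]
  · have hker : LinearMap.ker (π ∘ₗ eG.symm.toLinearMap) =
        LinearMap.range (LinearMap.lcomp R R ι.dualMap) := by
      ext ξ
      rw [LinearMap.mem_ker, LinearMap.comp_apply, hex]
      constructor
      · rintro ⟨y, hy⟩
        exact ⟨eK y, by rw [hcomm, hy]; exact eG.apply_symm_apply ξ⟩
      · rintro ⟨y, rfl⟩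
        obtain ⟨y, rfl⟩ := eK.surjective y
        exact ⟨y, by rw [hcomm]; exact (eG.symm_apply_apply _).symm⟩
    exact subsingleton_ext_congr_right (((Submodule.quotEquivOfEq _ _ hker).symm.trans
      ((π ∘ₗ eG.symm.toLinearMap).quotKerEquivOfSurjective
        (hπ.comp eG.symm.surjective))).symm) (hZ i hi)

/-- For `x` in the maximal ideal and regular on `L`, the quotient `L/xL` still has depth at least
`t`, so `x` is surjective on `L*`, and Nakayama applies. -/
lemma subsingleton_dual_of_isTotallyReflexive {t : ℕ} (ht : depth R R = t) {L : Type u}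
    [AddCommGroup L] [Module R L] (hL : IsTotallyReflexive R L)
    (hd : ∀ i ≤ t, Subsingleton (ExtGroup R (ResidueField R) L i)) :
    Subsingleton (Module.Dual R L) := by
  have := hL.finite
  obtain ⟨x, hxk, hx⟩ := IsSMulRegular.subsingleton_linearMap_iff.mp
    (subsingleton_ext_zero_iff.mp (hd 0 (Nat.zero_le _)))
  have hs := surjective_dualMap_of_exact ht hL hL (ι := LinearMap.lsmul R L x)
    hx (Submodule.mkQ_surjective _) (LinearMap.exact_lsmul_mkQ_smul_top L x)
    fun i hi => subsingleton_ext_quotSMulTop_right hx i (hd i hi.le) (hd (i + 1) hi)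
  rw [← Submodule.subsingleton_iff R, ← subsingleton_iff_bot_eq_top, eq_comm]
  refine Submodule.eq_bot_of_le_smul_of_le_jacobson_bot (Ideal.span {x}) ⊤ ?_ ?_ ?_
  · exact Module.Finite.fg_top
  · intro φ _
    obtain ⟨ψ, rfl⟩ := hs φ
    have : (LinearMap.lsmul R L x).dualMap ψ = x • ψ := by
      ext y
      simp
    rw [this]
    exact Submodule.smul_mem_smul (Ideal.mem_span_singleton_self x) trivial
  · rw [IsLocalRing.jacobson_eq_maximalIdeal _ bot_ne_top, Ideal.span_singleton_le_iff_mem]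
    exact annihilator_residueField_le hxk

/-- The inequality `Gdim L ≤ depth R - depth L` for modules of finite G-dimension, in terms of the
vanishing of `Ext`. -/
lemma HasGDimLE.subsingleton_ext {t : ℕ} (ht : depth R R = t) (n d : ℕ) {L : Type u}
    [AddCommGroup L] [Module R L] (h : HasGDimLE R n (ModuleCat.of R L))
    (hd : ∀ i < d, Subsingleton (ExtGroup R (ResidueField R) L i)) (i : ℕ) (hi : t < i + d) :
    Subsingleton (ExtGroup R L R i) := by
  have hpos : ∀ i, t < i + 1 + d → Subsingleton (ExtGroup R L R (i + 1)) := by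
    clear hi i
    induction n generalizing d L with
    | zero => exact fun i _ => IsTotallyReflexive.ext_succ h i
    | succ n ih =>
      obtain ⟨G, π, hG, hπ, hK⟩ := h
      have := hG.finite
      have hex := LinearMap.exact_subtype_ker_map π
      have hι := Submodule.injective_subtype (LinearMap.ker π)
      have hGd : ∀ i < t, Subsingleton (ExtGroup R (ResidueField R) G i) := fun i hi =>
        hG.ext_residueField ht i hi
      -- Passing to the kernel raises the depth bound by one, but not beyond the bound `t` known for
      -- `G`.
      have hKd : ∀ i < min t (d + 1),
          Subsingleton (ExtGroup R (ResidueField R) (LinearMap.ker π) i) := by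
        intro i hi
        cases i with
        | zero => exact subsingleton_ext_zero_of_injective hι (hGd 0 (by lia))
        | succ i => exact subsingleton_ext_right₁ hι hπ hex i (hd i (by lia)) (hGd _ (by lia))
      have hKE := ih (min t (d + 1)) hK hKd
      intro i hi
      cases i with
      | succ i =>
        exact subsingleton_ext_left₃ hι hπ hex (i + 1) (hKE i (by lia)) (hG.ext_succ _)
      | zero =>
        -- Here `d ≥ t`, so the kernel has all higher `Ext` zero and is totally reflexive; `Ext^1(L,
        -- R)` is then the cokernel of `G* → K*`.
        have hKr := HasGDimLE.isTotallyReflexive n hK fun i => hKE i (by lia)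
        have hs := surjective_dualMap_of_exact ht hKr hG hι hπ hex fun i hi => hd i (by lia)
        obtain ⟨δ, hδ, hδk⟩ := exists_connecting_linearMap (Y := R) hι hπ hex (hG.ext_succ 0)
        refine subsingleton_of_forall_eq 0 fun y => ?_
        obtain ⟨φ, rfl⟩ := hδ y
        have : φ ∈ LinearMap.ker δ := by
          rw [hδk]
          exact hs φ
        exact this
  cases i with
  | succ i => exact hpos i hi
  | zero =>
    rw [subsingleton_ext_zero_iff]
    exact subsingleton_dual_of_isTotallyReflexive ht
      (HasGDimLE.isTotallyReflexive n h fun i => hpos i (by lia)) fun i hi => hd i (by lia)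

end Local

end ARDuality

/-! ### Comparison of `Ext(N, M)` with the stable Hom -/

namespace ARDuality

open CategoryTheory Abelian IsLocalRing RingTheory.Sequence TensorProduct

variable {R : Type u} [CommRing R] [IsNoetherianRing R]
variable {M N : Type u} [AddCommGroup M] [Module R M] [Module.Finite R M]
  [AddCommGroup N] [Module R N] [Module.Finite R N]

lemma subsingleton_ext_of_smul_eq_zero {t : ℕ}
    (hMN : nonFreeLocus R M ∩ nonFreeLocus R N ⊆ depthLocus R t)
    (T : Type u) [AddCommGroup T] [Module R T]
    (hT : ∀ s ∈ stableAnnihilator R M ⊔ stableAnnihilator R N, ∀ y : T, s • y = 0) (i : ℕ)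
    (hi : i < t) : Subsingleton (ExtGroup R T R i) := by
  have := Module.finitePresentation_of_finite R M
  have := Module.finitePresentation_of_finite R N
  refine subsingleton_ext_of_zeroLocus_subset_depthLocus (fun p hp => hMN ?_) hT i hi
  rw [PrimeSpectrum.zeroLocus_sup] at hp
  exact ⟨zeroLocus_stableAnnihilator_subset hp.1, zeroLocus_stableAnnihilator_subset hp.2⟩

lemma nonempty_ext_projectiveHoms_equiv {n : ℕ} (hM : IsTorsionfree R (n + 2) M)
    (hMN : nonFreeLocus R M ∩ nonFreeLocus R N ⊆ depthLocus R (n + 1)) :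
    Nonempty (ExtGroup R N M n ≃ₗ[R] ExtGroup R (projectiveHoms R M N) R n) := by
  obtain ⟨hrefl, hE⟩ := hM.bijective_eval_and_ext_dual
  have hJ := subsingleton_ext_of_smul_eq_zero hMN
  obtain ⟨e⟩ := nonempty_ext_dual_equiv (A := Module.Dual R M) _ n hE
    (fun T _ _ hT i hi => hJ T hT i (by lia)) N
    (sup_le_sup_right stableAnnihilator_le_dual _)
  obtain ⟨e'⟩ := nonempty_ext_range_equiv (A := Module.Dual R M ⊗[R] N) (B := M →ₗ[R] N) (Y := R)
    (dualTensorHom R M N) n fun i hi => hJ _ (fun s hs y =>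
      Subtype.ext (smul_eq_zero_of_mem_ker_dualTensorHom hs y.2)) i (by lia)
  exact ⟨(extCongrRight N (LinearEquiv.ofBijective _ hrefl) n).trans (e.trans (e'.symm.trans
    (extCongrLeft (LinearEquiv.ofEq _ _ range_dualTensorHom_eq_projectiveHoms) R n)))⟩

variable [IsLocalRing R]

/-- `StableHom` is killed by `J`, so its `Ext^i(-, R)` already vanish for `i < t`; were it nonzero,
vanishing at `t` as well would give `depth R ≥ t + 1`. -/
lemma subsingleton_stableHom_of_ext {t : ℕ} (ht : depth R R = t)
    (hMN : nonFreeLocus R M ∩ nonFreeLocus R N ⊆ depthLocus R t)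
    (h : Subsingleton (ExtGroup R (StableHom R M N) R t)) : Subsingleton (StableHom R M N) := by
  by_contra hX
  rw [not_subsingleton_iff_nontrivial] at hX
  have : ((t + 1 : ℕ) : ℕ∞) ≤ depth R R := le_depth_of_subsingleton_ext (T := StableHom R M N)
    fun i hi => (Nat.lt_succ_iff_lt_or_eq.mp hi).elim
      (subsingleton_ext_of_smul_eq_zero hMN _ (fun s hs => stableHom_smul_eq_zero hs) i)
      (fun hi => hi ▸ h)
  rw [ht] at this
  exact absurd (Nat.cast_le.mp this) (by lia)

end ARDuality

open ARDuality

theorem mainTheorem7 {R : Type u} [CommRing R] [IsNoetherianRing R] [IsLocalRing R]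
    (M N : Type u) [AddCommGroup M] [Module R M] [Module.Finite R M]
    [AddCommGroup N] [Module R N] [Module.Finite R N]
    (t : ℕ) (ht : ARDuality.depth R R = (t : ℕ∞))
    (hM : ARDuality.IsTorsionfree R (t + 1) M)
    (hMN : ARDuality.nonFreeLocus R M ∩ ARDuality.nonFreeLocus R N ⊆ ARDuality.depthLocus R t) :
    (Subsingleton (ARDuality.extModule R (M →ₗ[R] N) R (t : ℤ)) →
      Subsingleton (ARDuality.extModule R N M ((t : ℤ) - 1)) →
      Subsingleton (ARDuality.StableHom R M N)) ∧
    ((2 : ℕ∞) ≤ ARDuality.depth R (M →ₗ[R] N) → ARDuality.HasFiniteGDim R (M →ₗ[R] N) →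
      Nonempty (ARDuality.extModule R N M ((t : ℤ) - 1) ≃ₗ[R]
        ARDuality.extModule R (ARDuality.StableHom R M N) R (t : ℤ)) ∧
      (Subsingleton (ARDuality.extModule R N M ((t : ℤ) - 1)) ↔
        Subsingleton (ARDuality.StableHom R M N))) := by
  have hX := subsingleton_stableHom_of_ext ht hMN
  have hI := Submodule.injective_subtype (projectiveHoms R M N)
  have hq := Submodule.mkQ_surjective (projectiveHoms R M N)
  have hex := LinearMap.exact_subtype_mkQ (projectiveHoms R M N)
  have hvanish : (2 : ℕ∞) ≤ depth R (M →ₗ[R] N) → HasFiniteGDim R (M →ₗ[R] N) → ∀ i, t < i + 2 →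
      Subsingleton (ExtGroup R (M →ₗ[R] N) R i) := fun hd ⟨n, hn⟩ i hi =>
    HasGDimLE.subsingleton_ext ht n 2 hn
      (fun i hi => subsingleton_ext_residueField_of_le_depth hd i hi) i hi
  cases t with
  -- For `t = 0` the module `Ext^{-1}` is zero by convention, and `StableHom` has zero dual as soon
  -- as `Hom(M, N)` has, being its quotient.
  | zero =>
    have hquot : Subsingleton (ExtGroup R (M →ₗ[R] N) R 0) →
        Subsingleton (ExtGroup R (StableHom R M N) R 0) :=
      subsingleton_ext_zero_of_surjective hq
    have hneg : Subsingleton (extModule R N M (((0 : ℕ) : ℤ) - 1)) :=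
      inferInstanceAs (Subsingleton PUnit)
    refine ⟨fun h _ => hX (hquot h), fun hd hg => ?_⟩
    have h0 : Subsingleton (extModule R (StableHom R M N) R ((0 : ℕ) : ℤ)) :=
      hquot (hvanish hd hg 0 (by lia))
    exact ⟨⟨0⟩, fun _ => hX h0, fun _ => hneg⟩
  | succ n =>
    have hcast : ((n + 1 : ℕ) : ℤ) - 1 = (n : ℤ) := by simp
    rw [hcast]
    obtain ⟨e⟩ := nonempty_ext_projectiveHoms_equiv hM hMN
    refine ⟨fun h h' => hX ?_, fun hd hg => ?_⟩
    · have h₁ : Subsingleton (ExtGroup R (projectiveHoms R M N) R n) :=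
        e.toEquiv.subsingleton_congr.mp h'
      exact subsingleton_ext_left₃ hI hq hex n h₁ h
    -- Depth at least `2` is what makes `Ext^i(Hom(M, N), R)` vanish in both degrees `t - 1` and
    -- `t`.
    · obtain ⟨e'⟩ := nonempty_ext_connecting_equiv (Y := R) hI hq hex n
        (hvanish hd hg n (by lia)) (hvanish hd hg (n + 1) (by lia))
      have E : ExtGroup R N M n ≃ₗ[R] ExtGroup R (StableHom R M N) R (n + 1) := e.trans e'
      exact ⟨⟨E⟩, fun h => hX (E.toEquiv.subsingleton_congr.mp h), fun _ =>
        E.toEquiv.subsingleton_congr.mpr (subsingleton_ext_of_subsingleton (n + 1))⟩
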